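/- Let $t \ge 1$, let $p_1 = 2, p_2, \dots, p_t$ be distinct primes, each congruent to $2$ modulo $3$, and put $n = 3\,p_1 p_2 \cdots p_t$. Let $\Sigma_n$ be the set of integers $-27dn^2$, where $d$ is a fundamental discriminant such that $\left(\frac{d}{7}\right) \neq 1$ and $\left(\frac{d}{p}\right) = 1$ for every prime $p \mid n$ (Kronecker symbols), and let $\Sigma_n^+$ be the set of positive elements of $\Sigma_n$. Let $D \in \Sigma_n^+$ and let $F = \mathbb{Q}(\sqrt{-3D})$. If the class group of (the ring of integers of) $F$ has no nontrivial $3$-torsion, i.e. $\mathrm{Cl}(F)[3] = 0$, then there are, up to isomorphism, exactly $2^t$ cubic fields of discriminant $D$. -/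

import Mathlib

open scoped NumberField

/-- `d` is a fundamental discriminant: either `d ≡ 1 (mod 4)` is squarefree, or `d = 4m` with `m`
squarefree and `m ≡ 2, 3 (mod 4)`.  (The value `d = 1` is allowed.) -/
def IsFundamentalDiscriminant (d : ℤ) : Prop :=
  (d % 4 = 1 ∧ Squarefree d) ∨
    ∃ m : ℤ, d = 4 * m ∧ Squarefree m ∧ (m % 4 = 2 ∨ m % 4 = 3)

/-- The Kronecker symbol `(a / p)` at a prime `p`.  For odd `p` it is the Legendre symbol; for
`p = 2` it is `0` if `a` is even, `1` if `a ≡ ±1 (mod 8)` and `-1` if `a ≡ ±3 (mod 8)`. -/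
def kroneckerAtPrime (a : ℤ) (p : ℕ) : ℤ :=
  if p = 2 then ZMod.χ₈ (a : ZMod 8) else jacobiSym a p

/-- The set `Σ_n` of integers `-27 d n²`, where `d` is a fundamental discriminant with
`(d / 7) ≠ 1` and `(d / p) = 1` for all primes `p ∣ n`. -/
def sigmaSet (n : ℕ) : Set ℤ :=
  {D | ∃ d : ℤ, D = -27 * d * (n : ℤ) ^ 2 ∧ IsFundamentalDiscriminant d ∧
    kroneckerAtPrime d 7 ≠ 1 ∧ ∀ p : ℕ, p.Prime → p ∣ n → kroneckerAtPrime d p = 1}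

/-- The subset `Σ_n⁺` of positive elements of `Σ_n`. -/
def sigmaPlus (n : ℕ) : Set ℤ :=
  {D | D ∈ sigmaSet n ∧ 0 < D}

/-- A cubic field of discriminant `D`: a number field of degree `3` over `ℚ` whose (absolute)
discriminant is `D`.  Number fields are countable, so `Type` contains all of them up to
isomorphism. -/
structure CubicFieldOfDiscr (D : ℤ) where
  carrier : Type
  [field : Field carrier]
  [numberField : NumberField carrier]
  finrank_eq : Module.finrank ℚ carrier = 3
  discr_eq : NumberField.discr carrier = D

attribute [instance] CubicFieldOfDiscr.field CubicFieldOfDiscr.numberField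

/-- Isomorphism of cubic fields of discriminant `D`. -/
def CubicFieldOfDiscr.isoSetoid (D : ℤ) : Setoid (CubicFieldOfDiscr D) where
  r K L := Nonempty (K.carrier ≃+* L.carrier)
  iseqv :=
    { refl := fun K => ⟨RingEquiv.refl K.carrier⟩
      symm := fun ⟨e⟩ => ⟨e.symm⟩
      trans := fun ⟨e⟩ ⟨f⟩ => ⟨e.trans f⟩ }

/-- The set of isomorphism classes of cubic fields of discriminant `D`. -/
def CubicFieldClasses (D : ℤ) : Type 1 :=
  Quotient (CubicFieldOfDiscr.isoSetoid D)

/-! Since $-3D = 81dn^2$, the field $F$ is $\mathbb{Q}(\sqrt d)$. As $D > 0$ and $2$ splits, $d$ is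
negative, squarefree and $\equiv 1 \pmod 8$; hence the ring of integers is `QuadOrder c` with $d =
4c+1$ and its units are $\pm 1$.

By Cardano, a cubic field $K$ of discriminant $-27d$ times a square is generated by $\theta = u +
u'$, where $u^3 = \alpha$ and $u'^3 = \bar\alpha$ with $\alpha \in F$ and $N(\alpha)$ a cube. One
may take $\alpha = \beta^2\bar\beta$, so that $\theta$ is a root of $X^3 - 3N(\beta)X -
N(\beta)\mathrm{Tr}(\beta)$; this is `HasCubicRoot`. Every such $K$ has a $\beta$
(`exists_hasCubicRoot`), $\beta$ determines $K$ (`HasCubicRoot.nonempty_ringEquiv`), and $K$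
determines $\beta$ up to cubes, rational factors and conjugation
(`HasCubicRoot.exists_cube_mul_eq`).

Modulo cubes and rational factors, $(\beta) = \mathfrak b\,\mathfrak e^3$ with $\mathfrak b$ a
product of split primes over distinct rational primes (`exists_isConjReduced`). Without $3$-torsion
in the class group, and because units are cubes, $\mathfrak b$ can be prescribed and then fixes
$\beta$ modulo cubes (`exists_span_eq_mul_cube`, `QuadOrder.exists_cube_mul_eq`).

If $3 \mid N(\mathfrak b)$, the discriminant of $K$ is $-27\,d\,N(\mathfrak b)^2$
(`HasCubicRoot.discr_eq`). An explicit lattice of trace-zero integers, together with $1$, has this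
discriminant; its index is $1$, because the cubic is Eisenstein at the primes dividing $N(\mathfrak
b)$ and $d$ is squarefree at the others.

So the fields correspond to reduced ideals of norm $n$ up to conjugation. Each of the $t+1$ split
primes dividing $n$ offers two choices, and conjugation flips all of them: $2^{t+1}/2 = 2^t$
(`card_cubicFieldClasses`). -/

section

open QuadraticAlgebra Polynomial

/-! ### The ring of integers of an imaginary quadratic field with $d \equiv 1 \pmod 4$. -/

/-- If `d` is squarefree and `g ^ 2` divides `d * y ^ 2`, then `g` divides `y`. -/
theorem Int.dvd_of_sq_dvd_squarefree_mul_sq {d g y : ℤ} (hd : Squarefree d)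
    (h : g ^ 2 ∣ d * y ^ 2) : g ∣ y := by
  by_cases hg : g = 0
  · subst hg
    have h0 : d * y ^ 2 = 0 := by simpa using h
    rcases mul_eq_zero.1 h0 with h1 | h1
    · exact absurd h1 hd.ne_zero
    · rw [pow_eq_zero_iff two_ne_zero] at h1
      simp [h1]
  obtain ⟨g', y', hco, hg', hy'⟩ := Int.exists_gcd_one (Int.gcd_pos_of_ne_zero_left y hg)
  set k : ℤ := (Int.gcd g y : ℤ) with hk
  have hk0 : k ≠ 0 := by
    rw [hk]; exact_mod_cast (Int.gcd_pos_of_ne_zero_left y hg).ne'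
  have h2 : g' ^ 2 ∣ d * y' ^ 2 := by
    have : k ^ 2 * g' ^ 2 ∣ k ^ 2 * (d * y' ^ 2) := by
      have e1 : k ^ 2 * g' ^ 2 = g ^ 2 := by rw [hg']; ring
      have e2 : k ^ 2 * (d * y' ^ 2) = d * y ^ 2 := by rw [hy']; ring
      rw [e1, e2]; exact h
    exact (mul_dvd_mul_iff_left (pow_ne_zero 2 hk0)).1 this
  have hco' : IsCoprime (g' ^ 2) (y' ^ 2) := (Int.isCoprime_iff_gcd_eq_one.2 hco).pow
  have h3 : g' ^ 2 ∣ d := hco'.dvd_of_dvd_mul_right h2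
  have h4 : IsUnit g' := hd g' (by rwa [← sq])
  rw [hg', hy']
  exact mul_dvd_mul h4.dvd dvd_rfl

/-- Coordinates of an algebraic integer `x + y √d`. -/
theorem exists_int_coords_of_isIntegral {F : Type*} [Field F] [CharZero F] {d c : ℤ}
    (hdc : d = 4 * c + 1) (hd : Squarefree d) (hneg : d < 0) {δ : F} (hδ : δ ^ 2 = (d : F))
    (x y : ℚ) (hz : IsIntegral ℤ ((x : F) + y * δ)) :
    ∃ a b : ℤ, x = a + b / 2 ∧ y = b / 2 := by
  have hδQ : ∀ r : ℚ, (r : F) ≠ δ := by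
    intro r hr
    have : ((r ^ 2 : ℚ) : F) = ((d : ℚ) : F) := by push_cast; rw [hr, hδ]
    have h2 : r ^ 2 = (d : ℚ) := by exact_mod_cast this
    have h3 : (d : ℚ) < 0 := by exact_mod_cast hneg
    nlinarith [sq_nonneg r]
  have hint : ∀ r : ℚ, IsIntegral ℤ (r : F) → ∃ n : ℤ, (n : ℚ) = r := by
    intro r hr
    have h1 : IsIntegral ℤ r := by
      have := (isIntegral_algebraMap_iff (R := ℤ) (A := ℚ) (B := F)
        (algebraMap ℚ F).injective (x := r)).1 (by simpa using hr)
      exact this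
    obtain ⟨n, hn⟩ := IsIntegrallyClosed.isIntegral_iff.1 h1
    exact ⟨n, by simpa using hn⟩
  by_cases hy : y = 0
  · subst hy
    obtain ⟨n, hn⟩ := hint x (by simpa using hz)
    exact ⟨n, 0, by simp [hn], by simp⟩
  set z : F := (x : F) + y * δ with hzdef
  set P : ℚ[X] := X ^ 2 + C (-2 * x) * X + C (x ^ 2 - d * y ^ 2) with hP
  have hPdeg : P.natDegree = 2 := by rw [hP]; compute_degree!
  have hPmon : P.Monic := by rw [hP]; monicity!
  have hPz : aeval z P = 0 := by
    rw [hP]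
    simp only [map_add, map_mul, map_pow, aeval_X, aeval_C, hzdef, eq_ratCast]
    push_cast
    linear_combination ((y : F) ^ 2) * hδ
  have hzQ : z ∉ (algebraMap ℚ F).range := by
    rintro ⟨r, hr⟩
    apply hδQ ((r - x) / y)
    have hy' : (y : F) ≠ 0 := by exact_mod_cast hy
    have : (r : F) = x + y * δ := by simpa [hzdef] using hr
    push_cast
    rw [this]; field_simp; ring
  have hzint : IsIntegral ℚ z := hz.tower_top
  have hmin : minpoly ℚ z = P := by
    refine (Polynomial.eq_of_monic_of_dvd_of_natDegree_le (minpoly.monic hzint) hPmon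
      (minpoly.dvd ℚ z hPz) ?_).symm
    rw [hPdeg]
    exact (minpoly.two_le_natDegree_iff hzint).2 hzQ
  -- Since `ℤ` is integrally closed, the minimal polynomial over `ℚ` of an integral element is the
  -- image of the one over `ℤ`.
  have hcoeff : ∀ i, ∃ n : ℤ, (n : ℚ) = P.coeff i := by
    intro i
    rw [← hmin, minpoly.isIntegrallyClosed_eq_field_fractions' ℚ hz]
    exact ⟨(minpoly ℤ z).coeff i, by rw [coeff_map]; simp⟩
  obtain ⟨T, hT⟩ := hcoeff 1
  obtain ⟨N, hN⟩ := hcoeff 0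
  have hT' : (T : ℚ) = -2 * x := by
    rw [hT, hP, coeff_add, coeff_add, coeff_C_mul, coeff_C, coeff_X_pow, coeff_X]; simp
  have hN' : (N : ℚ) = x ^ 2 - d * y ^ 2 := by
    rw [hN, hP, coeff_add, coeff_add, coeff_C_mul, coeff_C, coeff_X_pow, coeff_X]; simp
  -- `d (2y)^2 = T^2 - 4N`
  have h4 : (d : ℚ) * (2 * y) ^ 2 = ((T ^ 2 - 4 * N : ℤ) : ℚ) := by
    push_cast; rw [hT', hN']; ring
  have hb : ∃ b : ℤ, (b : ℚ) = 2 * y := by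
    have hden : ((2 * y).den : ℤ) ^ 2 ∣ d * ((2 * y).num) ^ 2 := by
      refine ⟨T ^ 2 - 4 * N, ?_⟩
      have h5 : (2 * y) = ((2 * y).num : ℚ) / ((2 * y).den : ℚ) := (Rat.num_div_den _).symm
      have h6 : ((2 * y).den : ℚ) ≠ 0 := by exact_mod_cast (2 * y).den_nz
      have h7 : (d : ℚ) * ((2 * y).num : ℚ) ^ 2 =
          ((2 * y).den : ℚ) ^ 2 * ((T ^ 2 - 4 * N : ℤ) : ℚ) := by
        rw [← h4]; nth_rewrite 3 [h5]; field_simp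
      exact_mod_cast h7
    have h8 := Int.dvd_of_sq_dvd_squarefree_mul_sq hd hden
    have h9 : IsCoprime ((2 * y).den : ℤ) (2 * y).num := by
      have := (2 * y).reduced
      rw [Int.isCoprime_iff_gcd_eq_one, Int.gcd_comm]
      simpa [Int.gcd] using this
    have h10 : IsUnit ((2 * y).den : ℤ) := h9.isUnit_of_dvd' dvd_rfl h8
    have h11 : (2 * y).den = 1 := by simpa [Int.isUnit_iff_natAbs_eq] using h10
    exact ⟨(2 * y).num, by rw [Rat.coe_int_num_of_den_eq_one h11]⟩
  obtain ⟨b, hb⟩ := hb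
  have h12 : d * b ^ 2 = T ^ 2 - 4 * N := by
    have : (d : ℚ) * (b : ℚ) ^ 2 = ((T ^ 2 - 4 * N : ℤ) : ℚ) := by rw [hb, h4]
    exact_mod_cast this
  -- With `2 * x = -T` and `2 * y = b`, the coordinate `a` has to be `(-T - b) / 2`; `d` odd makes
  -- `b` and `T` of equal parity.
  have hpar : (2 : ℤ) ∣ (-T - b) := by
    have h13 : (b ^ 2) % 2 = (T ^ 2) % 2 := by
      have : b ^ 2 - T ^ 2 = 2 * (-2 * N - 2 * c * b ^ 2) := by
        rw [hdc] at h12; linear_combination h12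
      omega
    have h14 : (2 : ℤ) ∣ b ^ 2 - T ^ 2 := by omega
    rcases Int.even_or_odd b with hb2 | hb2 <;> rcases Int.even_or_odd T with hT2 | hT2
    · obtain ⟨k, hk⟩ := hb2; obtain ⟨l, hl⟩ := hT2; omega
    · have e1 := hb2.pow_of_ne_zero two_ne_zero; have e2 := hT2.pow (n := 2)
      obtain ⟨k, hk⟩ := e1; obtain ⟨l, hl⟩ := e2; omega
    · have e1 := hb2.pow (n := 2); have e2 := hT2.pow_of_ne_zero two_ne_zero
      obtain ⟨k, hk⟩ := e1; obtain ⟨l, hl⟩ := e2; omega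
    · obtain ⟨k, hk⟩ := hb2; obtain ⟨l, hl⟩ := hT2; omega
  obtain ⟨a, ha⟩ := hpar
  refine ⟨a, b, ?_, by rw [hb]; ring⟩
  have : ((-T - b : ℤ) : ℚ) = ((2 * a : ℤ) : ℚ) := by rw [ha]
  push_cast at this
  rw [hT'] at this
  linarith

theorem four_mul_norm_quadraticAlgebra {c : ℤ} (z : QuadraticAlgebra ℤ c 1) :
    4 * z.norm = (2 * z.re + z.im) ^ 2 - (4 * c + 1) * z.im ^ 2 := by
  rw [norm_def]; ring

theorem norm_eq_zero_of_neg {c : ℤ} (hc : 4 * c + 1 < 0) {z : QuadraticAlgebra ℤ c 1}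
    (h : z.norm = 0) : z = 0 := by
  have h4 := four_mul_norm_quadraticAlgebra z
  have him : z.im = 0 := by
    by_contra h0
    have : 0 < z.im ^ 2 := by positivity
    nlinarith [sq_nonneg (2 * z.re + z.im)]
  have hre : z.re = 0 := by
    rw [h, him] at h4
    have : (2 * z.re) ^ 2 = 0 := by linarith
    simpa using this
  ext <;> simp [him, hre]

/-- The quadratic order `ℤ[(1 + √d)/2]` is the ring of integers of `ℚ(√d)`. -/
theorem nonempty_ringEquiv_ringOfIntegers {F : Type*} [Field F] [CharZero F] {d c : ℤ}
    (hdc : d = 4 * c + 1) (hd : Squarefree d) (hneg : d < 0) {δ : F} (hδ : δ ^ 2 = (d : F))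
    (hspan : ∀ z : F, ∃ x y : ℚ, z = x + y * δ) :
    Nonempty (QuadraticAlgebra ℤ c 1 ≃+* 𝓞 F) := by
  have hu : ((1 + δ) / 2) ^ 2 = (1 + δ) / 2 + (c : F) := by
    have : δ ^ 2 = 4 * c + 1 := by rw [hδ, hdc]; push_cast; ring
    linear_combination this / 4
  have hui : IsIntegral ℤ ((1 + δ) / 2) := by
    refine ⟨X ^ 2 - X - C c, by monicity!, ?_⟩
    rw [eval₂_sub, eval₂_sub, eval₂_pow, eval₂_X, eval₂_C, hu]; simp
  set u : 𝓞 F := ⟨(1 + δ) / 2, hui⟩ with hudef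
  have hu2 : u * u = c • (1 : 𝓞 F) + (1 : ℤ) • u := by
    apply NumberField.RingOfIntegers.ext
    have h1 : algebraMap (𝓞 F) F u = (1 + δ) / 2 := rfl
    show algebraMap (𝓞 F) F _ = algebraMap (𝓞 F) F _
    rw [one_smul, zsmul_eq_mul, mul_one, map_mul, map_add, map_intCast, h1]
    linear_combination hu
  let φ : QuadraticAlgebra ℤ c 1 →ₐ[ℤ] 𝓞 F := QuadraticAlgebra.lift ⟨u, hu2⟩
  refine ⟨RingEquiv.ofBijective φ ⟨?_, ?_⟩⟩
  · rw [injective_iff_map_eq_zero]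
    intro z hz
    apply norm_eq_zero_of_neg (hdc ▸ hneg)
    have h1 : φ (algebraMap ℤ _ z.norm) = 0 := by
      rw [algebraMap_norm_eq_mul_star, map_mul, hz, zero_mul]
    rw [AlgHom.commutes] at h1
    simpa using h1
  · intro z
    obtain ⟨x, y, hxy⟩ := hspan (z : F)
    obtain ⟨a, b, rfl, rfl⟩ := exists_int_coords_of_isIntegral hdc hd hneg hδ x y
      (hxy ▸ z.isIntegral_coe)
    refine ⟨⟨a, b⟩, ?_⟩
    apply NumberField.RingOfIntegers.ext
    rw [hxy]
    have : φ ⟨a, b⟩ = (a : 𝓞 F) + b * u := by simp [φ]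
    have h1 : algebraMap (𝓞 F) F u = (1 + δ) / 2 := rfl
    rw [this]
    show algebraMap (𝓞 F) F _ = _
    rw [map_add, map_mul, map_intCast, map_intCast, h1]
    push_cast
    ring

theorem exists_rat_coords_of_adjoin_eq_top {F : Type*} [Field F] [CharZero F] {d : ℤ}
    {δ : F} (hδ : δ ^ 2 = (d : F)) (hF : IntermediateField.adjoin ℚ {δ} = ⊤) (z : F) :
    ∃ x y : ℚ, z = x + y * δ := by
  have hint : IsIntegral ℚ δ := ⟨X ^ 2 - C (d : ℚ), by monicity!, by
    rw [eval₂_sub, eval₂_pow, eval₂_X, eval₂_C, hδ]; simp⟩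
  have hz : z ∈ Algebra.adjoin ℚ {δ} := by
    rw [← IntermediateField.adjoin_simple_toSubalgebra_of_isAlgebraic hint.isAlgebraic, hF]; trivial
  induction hz using Algebra.adjoin_induction with
  | mem w hw => exact ⟨0, 1, by simpa using hw⟩
  | algebraMap r => exact ⟨r, 0, by simp⟩
  | add w v _ _ h1 h2 =>
    obtain ⟨x, y, rfl⟩ := h1
    obtain ⟨x', y', rfl⟩ := h2
    exact ⟨x + x', y + y', by push_cast; ring⟩
  | mul w v _ _ h1 h2 =>
    obtain ⟨x, y, rfl⟩ := h1
    obtain ⟨x', y', rfl⟩ := h2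
    exact ⟨x * x' + y * y' * d, x * y' + x' * y, by push_cast; rw [← hδ]; ring⟩

theorem numberField_of_adjoin_sqrt {F : Type*} [Field F] [CharZero F] {d : ℤ}
    {δ : F} (hδ : δ ^ 2 = (d : F)) (hF : IntermediateField.adjoin ℚ {δ} = ⊤) : NumberField F := by
  have hint : IsIntegral ℚ δ := ⟨X ^ 2 - C (d : ℚ), by monicity!, by
    rw [eval₂_sub, eval₂_pow, eval₂_X, eval₂_C, hδ]; simp⟩
  have h1 : FiniteDimensional ℚ (IntermediateField.adjoin ℚ {δ}) :=
    IntermediateField.adjoin.finiteDimensional hint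
  rw [hF] at h1
  have h2 : FiniteDimensional ℚ F := IntermediateField.topEquiv.toLinearEquiv.finiteDimensional
  exact {}

/-! ### Conjugation and norms of ideals in a quadratic order. -/

/-- The quadratic order `ℤ[ω]` with `ω ^ 2 = ω + c`, of discriminant `4 * c + 1`. -/
abbrev QuadOrder (c : ℤ) := QuadraticAlgebra ℤ c 1

namespace QuadOrder

open Ideal

variable {c : ℤ}

/-- The conjugate of an ideal of a quadratic order. -/
def conj (I : Ideal (QuadOrder c)) : Ideal (QuadOrder c) :=
  I.map (starRingAut : QuadOrder c ≃+* QuadOrder c)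

theorem star_mem_conj {I : Ideal (QuadOrder c)} {x : QuadOrder c} (hx : x ∈ I) :
    star x ∈ conj I :=
  Ideal.mem_map_of_mem (starRingAut : QuadOrder c ≃+* QuadOrder c) hx

theorem conj_span_singleton (x : QuadOrder c) : conj (span {x}) = span {star x} := by
  rw [conj, Ideal.map_span, Set.image_singleton]; rfl

theorem conj_span_pair (x y : QuadOrder c) : conj (span {x, y}) = span {star x, star y} := by
  rw [conj, Ideal.map_span, Set.image_pair]; rfl

theorem conj_mul (I J : Ideal (QuadOrder c)) : conj (I * J) = conj I * conj J :=
  Ideal.map_mul _ _ _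

theorem conj_pow (I : Ideal (QuadOrder c)) (k : ℕ) : conj (I ^ k) = conj I ^ k :=
  Ideal.map_pow _ _ _

theorem conj_conj (I : Ideal (QuadOrder c)) : conj (conj I) = I := by
  have h := Ideal.map_map (I := I)
    ((starRingAut : QuadOrder c ≃+* QuadOrder c) : QuadOrder c →+* QuadOrder c)
    ((starRingAut : QuadOrder c ≃+* QuadOrder c) : QuadOrder c →+* QuadOrder c)
  have h2 : ((starRingAut : QuadOrder c ≃+* QuadOrder c) : QuadOrder c →+* QuadOrder c).comp
    ((starRingAut : QuadOrder c ≃+* QuadOrder c) : QuadOrder c →+* QuadOrder c) = RingHom.id _ := by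
    apply RingHom.ext; intro x; exact star_star x
  rw [h2, Ideal.map_id] at h
  exact h

theorem mem_conj_iff {I : Ideal (QuadOrder c)} {x : QuadOrder c} :
    x ∈ conj I ↔ star x ∈ I := by
  constructor
  · intro h
    have := star_mem_conj h
    rwa [conj_conj] at this
  · intro h
    have := star_mem_conj h
    rwa [star_star] at this

theorem conj_injective : Function.Injective (conj (c := c)) := fun I J h => by
  rw [← conj_conj I, h, conj_conj]

theorem conj_dvd_conj {I J : Ideal (QuadOrder c)} : conj I ∣ conj J ↔ I ∣ J := by
  constructor
  · rintro ⟨K, hK⟩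
    refine ⟨conj K, ?_⟩
    rw [← conj_conj J, hK, conj_mul, conj_conj]
  · rintro ⟨K, hK⟩
    exact ⟨conj K, by rw [hK, conj_mul]⟩

theorem conj_bot : conj (⊥ : Ideal (QuadOrder c)) = ⊥ := Ideal.map_bot

theorem conj_ne_bot {I : Ideal (QuadOrder c)} (h : I ≠ ⊥) : conj I ≠ ⊥ := fun h1 =>
  h (conj_injective (h1.trans conj_bot.symm))

theorem conj_isPrime {I : Ideal (QuadOrder c)} (h : I.IsPrime) : (conj I).IsPrime :=
  Ideal.map_isPrime_of_equiv _

theorem intCast_dvd_intCast {m n : ℤ} : (m : QuadOrder c) ∣ n ↔ m ∣ n := by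
  simpa using QuadraticAlgebra.algebraMap_dvd_iff_dvd (R := ℤ) (a := c) (b := 1) (z := m) (w := n)

theorem intCast_norm (z : QuadOrder c) : ((z.norm : ℤ) : QuadOrder c) = z * star z := by
  rw [← algebraMap_norm_eq_mul_star]; simp

theorem intCast_trace (z : QuadOrder c) : ((trace z : ℤ) : QuadOrder c) = z + star z := by
  rw [← algebraMap_trace_eq_add_star]; simp

/-- The quotient $z/g$ has integral trace and norm, and squarefreeness of the discriminant makes the
order maximal, so $z/g$ lies in it. -/
theorem intCast_dvd_of_trace_norm (hd : Squarefree (4 * c + 1)) {g : ℤ} {z : QuadOrder c}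
    (ht : g ∣ trace z) (hn : g ^ 2 ∣ z.norm) : (g : QuadOrder c) ∣ z := by
  have h4 := four_mul_norm_quadraticAlgebra z
  rw [trace_def, one_mul] at ht
  have h1 : g ^ 2 ∣ (4 * c + 1) * z.im ^ 2 := by
    have : (4 * c + 1) * z.im ^ 2 = (2 * z.re + z.im) ^ 2 - 4 * z.norm := by linarith
    rw [this]
    exact dvd_sub (pow_dvd_pow_of_dvd ht 2) (hn.mul_left 4)
  obtain ⟨y, hy⟩ := Int.dvd_of_sq_dvd_squarefree_mul_sq hd h1
  obtain ⟨t, ht⟩ := ht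
  obtain ⟨s, hs⟩ := hn
  by_cases hg : g = 0
  · subst hg
    have him : z.im = 0 := by simpa using hy
    have hre : z.re = 0 := by rw [him] at ht; simpa using ht
    have : z = 0 := by ext <;> simp [him, hre]
    simp [this]
  -- `2 re = g (t - y)`, and `t - y` is even
  have h2 : 2 * z.re = g * (t - y) := by rw [hy] at ht; linarith
  have h3 : (t - y) ^ 2 + 2 * (t - y) * y - 4 * c * y ^ 2 = 4 * s := by
    have : g ^ 2 * ((t - y) ^ 2 + 2 * (t - y) * y - 4 * c * y ^ 2) = g ^ 2 * (4 * s) := by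
      rw [hs, ht, hy] at h4
      linear_combination -h4
    exact mul_left_cancel₀ (pow_ne_zero 2 hg) this
  have h5 : Even (t - y) := by
    have : Even ((t - y) ^ 2) :=
      ⟨2 * s + 2 * c * y ^ 2 - (t - y) * y, by linear_combination h3⟩
    exact (Int.even_pow' two_ne_zero).1 this
  obtain ⟨k, hk⟩ := h5
  refine ⟨⟨k, y⟩, ?_⟩
  have hre : z.re = g * k := by rw [hk] at h2; linarith
  ext
  · simp [hre]
  · simp [hy]

variable [IsDedekindDomain (QuadOrder c)]

theorem absNorm_span_singleton_eq (z : QuadOrder c) : absNorm (span {z}) = z.norm.natAbs := by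
  rw [Ideal.absNorm_span_singleton, Algebra.norm_apply, ← det_toLinearMap_eq_norm]
  rfl

theorem absNorm_span_intCast (g : ℤ) :
    absNorm (span {(g : QuadOrder c)}) = g.natAbs ^ 2 := by
  rw [absNorm_span_singleton_eq, norm_intCast, Int.natAbs_pow, Int.cast_id]

theorem absNorm_conj (I : Ideal (QuadOrder c)) : absNorm (conj I) = absNorm I := by
  rw [Ideal.absNorm_apply, Ideal.absNorm_apply, Submodule.cardQuot_apply, Submodule.cardQuot_apply]
  exact (Nat.card_congr (Ideal.quotientEquiv I (conj I) starRingAut rfl).toEquiv).symm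

/-- The product of an ideal and its conjugate is generated by the norm. -/
theorem mul_conj (hd : Squarefree (4 * c + 1)) (I : Ideal (QuadOrder c)) :
    I * conj I = span {((absNorm I : ℤ) : QuadOrder c)} := by
  by_cases hI : I = ⊥
  · subst hI; simp
  have key : ∃ g : ℤ, I * conj I = span {(g : QuadOrder c)} := by
    obtain ⟨a, haI, ha⟩ := Submodule.exists_mem_ne_zero_of_ne_bot hI
    obtain ⟨b, hb⟩ := IsDedekindDomain.exists_sup_span_eq
      ((Ideal.span_singleton_le_iff_mem I).2 haI) (by simpa using ha)
    have hIab : I = span {a, b} := by rw [← hb, Ideal.span_insert]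
    -- The generator is the gcd of $N(a)$, $N(b)$ and $\mathrm{Tr}(a\bar b)$. It divides the trace
    -- of $a\bar b$ and its square divides the norm, so it divides $a\bar b$ itself.
    set T : ℤ := trace (a * star b) with hT
    set g1 : ℤ := (Int.gcd a.norm b.norm : ℤ) with hg1
    set g : ℤ := (Int.gcd g1 T : ℤ) with hg
    have hga : g ∣ a.norm := (Int.gcd_dvd_left ..).trans (Int.gcd_dvd_left ..)
    have hgb : g ∣ b.norm := (Int.gcd_dvd_left ..).trans (Int.gcd_dvd_right ..)
    have hgT : g ∣ T := Int.gcd_dvd_right ..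
    have hgz : (g : QuadOrder c) ∣ a * star b := by
      apply intCast_dvd_of_trace_norm hd hgT
      rw [map_mul, QuadraticAlgebra.norm_star, sq]
      exact mul_dvd_mul hga hgb
    have hgz' : (g : QuadOrder c) ∣ star a * b := by
      obtain ⟨w, hw⟩ := hgz
      refine ⟨star w, ?_⟩
      have := congrArg star hw
      rw [star_mul, star_mul, star_star] at this
      rw [mul_comm, this]; simp [mul_comm]
    refine ⟨g, ?_⟩
    rw [hIab, conj_span_pair, Ideal.span_pair_mul_span_pair]
    apply le_antisymm
    · rw [Ideal.span_le]
      rintro x (rfl | rfl | rfl | rfl)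
      · exact Ideal.mem_span_singleton.2 (intCast_norm a ▸ intCast_dvd_intCast.2 hga)
      · exact Ideal.mem_span_singleton.2 hgz
      · exact Ideal.mem_span_singleton.2 (mul_comm b (star a) ▸ hgz')
      · exact Ideal.mem_span_singleton.2 (intCast_norm b ▸ intCast_dvd_intCast.2 hgb)
    · rw [Ideal.span_singleton_le_iff_mem]
      have e1 := Int.gcd_eq_gcd_ab g1 T
      have e2 := Int.gcd_eq_gcd_ab a.norm b.norm
      rw [← hg] at e1
      rw [← hg1] at e2
      have e3 : (g : QuadOrder c) = (a * star a * (Int.gcdA a.norm b.norm : QuadOrder c)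
          + b * star b * (Int.gcdB a.norm b.norm : QuadOrder c)) * (Int.gcdA g1 T : QuadOrder c)
          + (a * star b + b * star a) * (Int.gcdB g1 T : QuadOrder c) := by
        have e4 : a * star b + b * star a = ((T : ℤ) : QuadOrder c) := by
          rw [hT, intCast_trace, star_mul, star_star]
        rw [e4, ← intCast_norm, ← intCast_norm]
        conv_lhs => rw [e1]
        rw [e2]; push_cast; rw [← e2]
      rw [e3]
      have m1 : a * star a ∈ span {a * star a, a * star b, b * star a, b * star b} :=
        Ideal.subset_span (by simp)
      have m2 : a * star b ∈ span {a * star a, a * star b, b * star a, b * star b} :=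
        Ideal.subset_span (by simp)
      have m3 : b * star a ∈ span {a * star a, a * star b, b * star a, b * star b} :=
        Ideal.subset_span (by simp)
      have m4 : b * star b ∈ span {a * star a, a * star b, b * star a, b * star b} :=
        Ideal.subset_span (by simp)
      exact Ideal.add_mem _ (Ideal.mul_mem_right _ _ (Ideal.add_mem _ (Ideal.mul_mem_right _ _ m1)
        (Ideal.mul_mem_right _ _ m4))) (Ideal.mul_mem_right _ _ (Ideal.add_mem _ m2 m3))
  obtain ⟨g, hg⟩ := key
  have h1 : absNorm I ^ 2 = g.natAbs ^ 2 := by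
    rw [← absNorm_span_intCast (c := c), ← hg, map_mul, absNorm_conj, sq]
  have h2 : absNorm I = g.natAbs := Nat.pow_left_injective two_ne_zero h1
  rw [hg, h2, Ideal.span_singleton_eq_span_singleton]
  rcases Int.natAbs_eq g with h | h
  · rw [← h]
  · nth_rewrite 1 [h]; rw [Int.cast_neg]; exact (Associated.refl _).neg_left

end QuadOrder

/-! ### Conjugation-reduced ideals and elements modulo cubes. -/

namespace QuadOrder

open Ideal

variable {c : ℤ}

/-- An ideal of a quadratic order is conjugation-reduced if it is a product of distinct primes,
no two of which are conjugate and none of which is its own conjugate. -/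
def IsConjReduced (I : Ideal (QuadOrder c)) : Prop :=
  ∀ P : Ideal (QuadOrder c), P.IsPrime → P ≠ ⊥ → P ∣ I → ¬ P ^ 2 ∣ I ∧ ¬ conj P ∣ I

theorem IsConjReduced.conj {I : Ideal (QuadOrder c)} (h : IsConjReduced I) :
    IsConjReduced (conj I) := by
  intro P hP hP0 hPI
  have h1 : QuadOrder.conj P ∣ I := by rwa [← conj_dvd_conj, conj_conj]
  obtain ⟨h2, h3⟩ := h _ (conj_isPrime hP) (conj_ne_bot hP0) h1
  refine ⟨fun h4 => h2 ?_, fun h4 => h3 ?_⟩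
  · rwa [← conj_dvd_conj, conj_pow, conj_conj]
  · rwa [← conj_dvd_conj, conj_conj]

theorem norm_nonneg (hc : 4 * c + 1 < 0) (z : QuadOrder c) : 0 ≤ z.norm := by
  have := four_mul_norm_quadraticAlgebra z
  nlinarith [sq_nonneg (2 * z.re + z.im), sq_nonneg z.im]

theorem norm_ne_zero (hc : 4 * c + 1 < 0) {z : QuadOrder c} (hz : z ≠ 0) : z.norm ≠ 0 :=
  fun h => hz (norm_eq_zero_of_neg hc h)

/-- The bound on `c` excludes discriminant $-3$. The point is that every unit is then a cube. -/
theorem isUnit_eq_one_or (hc : c ≤ -2) {u : QuadOrder c} (hu : IsUnit u) : u = 1 ∨ u = -1 := by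
  rw [isUnit_iff_norm_isUnit, Int.isUnit_iff] at hu
  have h0 := norm_nonneg (by omega : 4 * c + 1 < 0) u
  have h1 : u.norm = 1 := by omega
  have h4 := four_mul_norm_quadraticAlgebra u
  have him : u.im = 0 := by
    by_contra h
    have : 1 ≤ u.im ^ 2 := by
      have : 0 < u.im ^ 2 := by positivity
      omega
    nlinarith [sq_nonneg (2 * u.re + u.im)]
  have hre : u.re ^ 2 = 1 := by
    rw [h1, him] at h4; linarith
  rcases sq_eq_one_iff.1 hre with h | h
  · left; ext <;> simp [h, him]
  · right; ext <;> simp [h, him]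

variable [IsDedekindDomain (QuadOrder c)]

theorem absNorm_ne_zero (hd : Squarefree (4 * c + 1)) {I : Ideal (QuadOrder c)} (hI : I ≠ ⊥) :
    absNorm I ≠ 0 := by
  intro h
  have h1 := mul_conj hd I
  rw [h] at h1
  simp only [Nat.cast_zero, Int.cast_zero, Ideal.span_singleton_zero, ← Ideal.zero_eq_bot,
    mul_eq_zero] at h1
  rcases h1 with h1 | h1
  · exact hI h1
  · exact conj_ne_bot hI h1

theorem mul_conj_dvd_of_ne {P I : Ideal (QuadOrder c)} (hP : P.IsPrime) (hP0 : P ≠ ⊥)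
    (hne : P ≠ conj P) (h1 : P ∣ I) (h2 : conj P ∣ I) : P * conj P ∣ I := by
  have hm := hP.isMaximal hP0
  have hm' := (conj_isPrime hP).isMaximal (conj_ne_bot hP0)
  have hco : IsCoprime P (conj P) := Ideal.isCoprime_iff_sup_eq.2 (hm.coprime_of_ne hm' hne)
  exact hco.mul_dvd h1 h2

/-- Every nonzero element agrees up to rational factors with one generating
`b * e ^ 3` with `b` conjugation-reduced. -/
theorem exists_isConjReduced (hd : Squarefree (4 * c + 1)) (N : ℕ) :
    ∀ (β : QuadOrder c) (b e : Ideal (QuadOrder c)), β ≠ 0 → span {β} = b * e ^ 3 →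
      absNorm b = N → ∃ (r s : ℤ) (β' : QuadOrder c) (b' e' : Ideal (QuadOrder c)),
        r ≠ 0 ∧ s ≠ 0 ∧ β' ≠ 0 ∧ (s : QuadOrder c) * β' = r * β ∧ span {β'} = b' * e' ^ 3 ∧
        IsConjReduced b' := by
  induction N using Nat.strong_induction_on with
  | _ N ih =>
  intro β b e hβ hspan hN
  by_cases hred : IsConjReduced b
  · exact ⟨1, 1, β, b, e, one_ne_zero, one_ne_zero, hβ, by simp, hspan, hred⟩
  have hb0 : b ≠ ⊥ := by
    rintro rfl
    rw [← Ideal.zero_eq_bot, zero_mul, Ideal.zero_eq_bot, Ideal.span_singleton_eq_bot] at hspan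
    exact hβ hspan
  unfold IsConjReduced at hred
  push Not at hred
  obtain ⟨P, hP, hP0, hPb, hbad⟩ := hred
  set q : ℤ := (absNorm P : ℤ) with hq
  have hPn0 : absNorm P ≠ 0 := absNorm_ne_zero hd hP0
  have hq0 : q ≠ 0 := by rw [hq]; exact_mod_cast hPn0
  have hPn1 : absNorm P ≠ 1 := fun h => hP.ne_top (Ideal.absNorm_eq_one_iff.1 h)
  have hPn : 1 < absNorm P := by omega
  have hqP : span {(q : QuadOrder c)} = P * conj P := (mul_conj hd P).symm
  have hqR : (q : QuadOrder c) ≠ 0 := by exact_mod_cast hq0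
  have hmulspan : span {(q : QuadOrder c) * β} = P * conj P * (b * e ^ 3) := by
    rw [← Ideal.span_singleton_mul_span_singleton, hqP, hspan]
  have hpos : ∀ g : Ideal (QuadOrder c), g ∣ b → 0 < absNorm g := by
    intro g hg
    have : g ≠ ⊥ := by
      rintro rfl
      exact hb0 (by simpa using zero_dvd_iff.1 hg)
    exact Nat.pos_of_ne_zero (absNorm_ne_zero hd this)
  have finish : ∀ (g f : Ideal (QuadOrder c)), span {(q : QuadOrder c) * β} = g * f ^ 3 →
      absNorm g < N → ∃ (r s : ℤ) (β' : QuadOrder c) (b' e' : Ideal (QuadOrder c)),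
        r ≠ 0 ∧ s ≠ 0 ∧ β' ≠ 0 ∧ (s : QuadOrder c) * β' = r * β ∧ span {β'} = b' * e' ^ 3 ∧
        IsConjReduced b' := by
    intro g f hgf hlt
    obtain ⟨r, s, β', b', e', hr, hs, hβ', h1, h2, h3⟩ :=
      ih _ hlt (q * β) g f (mul_ne_zero hqR hβ) hgf rfl
    exact ⟨r * q, s, β', b', e', mul_ne_zero hr hq0, hs, hβ', by rw [h1]; push_cast; ring, h2, h3⟩
  -- Descent on $N(b)$. For $b = P^2g$, multiplication by $q = P\bar P$ gives $(\bar P g)(Pe)^3$,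
  -- which trades $P^2$ for $\bar P$.
  by_cases hPP : P ^ 2 ∣ b
  · obtain ⟨g, hg⟩ := hPP
    have hgpos := hpos g ⟨P ^ 2, by rw [hg, mul_comm]⟩
    refine finish (conj P * g) (P * e) (by rw [hmulspan, hg]; ring) ?_
    rw [← hN, hg, map_mul, map_mul, absNorm_conj, map_pow, sq]
    exact Nat.mul_lt_mul_of_pos_right (by nlinarith) hgpos
  · have hcP := hbad hPP
    -- For $P = \bar P$ and $b = Pg$, multiplication by $q = P^2$ completes a cube: $g\,(Pe)^3$.
    by_cases hself : P = conj P
    · obtain ⟨g, hg⟩ := hPb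
      have hgpos := hpos g ⟨P, by rw [hg, mul_comm]⟩
      refine finish g (P * e) (by rw [hmulspan, hg, ← hself]; ring) ?_
      rw [← hN, hg, map_mul]
      nlinarith
    -- Here $P\bar P = (q)$ divides $b$, so the rational factor $q$ is divided out of $\beta$.
    · obtain ⟨g, hg⟩ := mul_conj_dvd_of_ne hP hP0 hself hPb hcP
      have hgpos := hpos g ⟨P * conj P, by rw [hg, mul_comm]⟩
      have hle : (q : QuadOrder c) ∣ β := by
        rw [← Ideal.span_singleton_le_span_singleton, hspan, hg, ← hqP, mul_assoc]
        exact Ideal.mul_le_left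
      obtain ⟨β1, rfl⟩ := hle
      have hβ1 : β1 ≠ 0 := right_ne_zero_of_mul hβ
      have hs1 : span {β1} = g * e ^ 3 := by
        rw [← Ideal.span_singleton_mul_span_singleton, hg, ← hqP, mul_assoc] at hspan
        exact mul_left_cancel₀ (by simpa using hqR) hspan
      have hlt : absNorm g < N := by
        rw [← hN, hg, map_mul, map_mul, absNorm_conj]
        have h2 : 2 ≤ absNorm P * absNorm P := by nlinarith
        nlinarith
      obtain ⟨r, s, β', b', e', hr, hs, hβ', h1, h2, h3⟩ := ih _ hlt β1 g e hβ1 hs1 rfl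
      exact ⟨r, s * q, β', b', e', hr, mul_ne_zero hs hq0, hβ', by
        push_cast; linear_combination (q : QuadOrder c) * h1, h2, h3⟩

open scoped nonZeroDivisors in
/-- If the class group has no `3`-torsion, every ideal becomes principal after multiplication
by the cube of an ideal, which can be chosen prime to a given integer. -/
theorem exists_span_eq_mul_cube [Finite (ClassGroup (QuadOrder c))]
    (hCl : ∀ x : ClassGroup (QuadOrder c), x ^ 3 = 1 → x = 1)
    {b : Ideal (QuadOrder c)} (hb : b ≠ ⊥) {m : ℤ} (hm : m ≠ 0) :
    ∃ (β : QuadOrder c) (e : Ideal (QuadOrder c)), β ≠ 0 ∧ span {β} = b * e ^ 3 ∧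
      IsCoprime e (span {(m : QuadOrder c)}) := by
  -- Cubing is injective on a finite group without $3$-torsion, hence surjective, so the inverse
  -- class of `b` is a cube.
  have hinj : Function.Injective (powMonoidHom 3 : ClassGroup (QuadOrder c) →* _) := by
    rw [injective_iff_map_eq_one]; exact hCl
  have hsurj := Finite.injective_iff_surjective.1 hinj
  set b0 : (Ideal (QuadOrder c))⁰ := ⟨b, mem_nonZeroDivisors_of_ne_zero hb⟩ with hb0
  obtain ⟨x, hx⟩ := hsurj (ClassGroup.mk0 b0)⁻¹
  change x ^ 3 = _ at hx
  obtain ⟨I, hI⟩ := ClassGroup.mk0_surjective x⁻¹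
  have hI0 : (I : Ideal (QuadOrder c)) ≠ 0 := nonZeroDivisors.coe_ne_zero I
  -- An ideal `e` in the class `x` and prime to `m` is $(a)I^{-1}$, where $I$ has class $x^{-1}$ and
  -- `a` generates $I$ modulo $2mI$. The factor `2` makes the modulus a nonunit, which rules out `e
  -- = ⊥`.
  have h2m : ((2 * m : ℤ) : QuadOrder c) ≠ 0 := by exact_mod_cast mul_ne_zero two_ne_zero hm
  obtain ⟨a, ha⟩ := IsDedekindDomain.exists_sup_span_eq
    (I := (I : Ideal (QuadOrder c)) * span {((2 * m : ℤ) : QuadOrder c)}) (J := I)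
    Ideal.mul_le_left (mul_ne_zero hI0 (by simpa using h2m))
  have haI : span {a} ≤ (I : Ideal (QuadOrder c)) := ha ▸ le_sup_right
  obtain ⟨e, he⟩ := Ideal.dvd_iff_le.2 haI
  have hco : span {((2 * m : ℤ) : QuadOrder c)} ⊔ e = ⊤ := by
    have h1 : (I : Ideal (QuadOrder c)) * (span {((2 * m : ℤ) : QuadOrder c)} ⊔ e) = I * ⊤ := by
      rw [Ideal.mul_sup, ← he, ha, Ideal.mul_top]
    exact mul_left_cancel₀ hI0 h1
  have he0 : e ≠ ⊥ := by
    rintro rfl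
    rw [sup_bot_eq, ← Ideal.absNorm_eq_one_iff, absNorm_span_intCast] at hco
    have h3 : (2 * m).natAbs = 1 := by simpa using hco
    omega
  have ha0 : a ≠ 0 := by
    rintro rfl
    rw [Ideal.span_singleton_zero] at he
    rcases mul_eq_zero.1 (he.symm.trans Ideal.zero_eq_bot.symm) with h | h
    · exact hI0 h
    · exact he0 h
  set e0 : (Ideal (QuadOrder c))⁰ := ⟨e, mem_nonZeroDivisors_of_ne_zero he0⟩ with he0'
  have hmk : ClassGroup.mk0 e0 = x := by
    have h1 : ClassGroup.mk0 (I * e0) = 1 := by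
      have : ((I * e0 : (Ideal (QuadOrder c))⁰) : Ideal (QuadOrder c)) = span {a} := by
        rw [he]; rfl
      rw [← Subtype.coe_eta (I * e0) (I * e0).2, ClassGroup.mk0_eq_one_iff, this]
      exact ⟨a, rfl⟩
    rw [map_mul, hI] at h1
    rwa [inv_mul_eq_one, eq_comm] at h1
  have hprin : ClassGroup.mk0 (b0 * e0 ^ 3) = 1 := by
    rw [map_mul, map_pow, hmk, hx, mul_inv_cancel]
  rw [← Subtype.coe_eta (b0 * e0 ^ 3) (b0 * e0 ^ 3).2, ClassGroup.mk0_eq_one_iff] at hprin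
  obtain ⟨β, hβ⟩ := hprin
  have hβ' : span {β} = b * e ^ 3 := hβ.symm
  refine ⟨β, e, ?_, hβ', ?_⟩
  · rintro rfl
    rw [Ideal.span_singleton_zero] at hβ'
    exact mul_ne_zero hb (pow_ne_zero 3 he0) hβ'.symm
  · rw [Ideal.isCoprime_iff_sup_eq, sup_comm]
    refine eq_top_iff.2 (hco ▸ sup_le_sup_right ?_ _)
    rw [Ideal.span_singleton_le_span_singleton, intCast_dvd_intCast]
    exact dvd_mul_left _ _

open scoped nonZeroDivisors in
/-- If the class group has no `3`-torsion, the generator of `b * e ^ 3` is determined by `b`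
up to cubes. -/
theorem exists_cube_mul_eq (hc : c ≤ -2)
    (hCl : ∀ x : ClassGroup (QuadOrder c), x ^ 3 = 1 → x = 1)
    {b e e' : Ideal (QuadOrder c)} {β β' : QuadOrder c} (hβ : β ≠ 0) (hβ' : β' ≠ 0)
    (h : span {β} = b * e ^ 3) (h' : span {β'} = b * e' ^ 3) :
    ∃ x y : QuadOrder c, x ≠ 0 ∧ y ≠ 0 ∧ x ^ 3 * β = y ^ 3 * β' := by
  have hne : b * e ^ 3 ≠ 0 := by rw [← h]; simpa using hβ
  have hne' : b * e' ^ 3 ≠ 0 := by rw [← h']; simpa using hβ'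
  have hb := left_ne_zero_of_mul hne
  have he : e ≠ 0 := fun h0 => hne (by simp [h0])
  have he' : e' ≠ 0 := fun h0 => hne' (by simp [h0])
  set b0 : (Ideal (QuadOrder c))⁰ := ⟨b, mem_nonZeroDivisors_of_ne_zero hb⟩ with hb0
  set e0 : (Ideal (QuadOrder c))⁰ := ⟨e, mem_nonZeroDivisors_of_ne_zero he⟩ with he0
  set f0 : (Ideal (QuadOrder c))⁰ := ⟨e', mem_nonZeroDivisors_of_ne_zero he'⟩ with hf0
  have key : ∀ (g : (Ideal (QuadOrder c))⁰) (γ : QuadOrder c),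
      (g : Ideal (QuadOrder c)) = span {γ} → ClassGroup.mk0 g = 1 := by
    intro g γ hg
    rw [← Subtype.coe_eta g g.2, ClassGroup.mk0_eq_one_iff, hg]
    exact ⟨γ, rfl⟩
  have h1 : ClassGroup.mk0 (b0 * e0 ^ 3) = 1 := key _ β h.symm
  have h2 : ClassGroup.mk0 (b0 * f0 ^ 3) = 1 := key _ β' h'.symm
  have h3 : ClassGroup.mk0 e0 = ClassGroup.mk0 f0 := by
    rw [← div_eq_one]
    apply hCl
    rw [div_pow, div_eq_one]
    rw [map_mul, map_pow] at h1 h2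
    exact mul_left_cancel (h1.trans h2.symm)
  rw [ClassGroup.mk0_eq_mk0_iff] at h3
  obtain ⟨x, y, hx, hy, hxy⟩ := h3
  change span {x} * e = span {y} * e' at hxy
  have h4 : span {x ^ 3 * β} = span {y ^ 3 * β'} := by
    rw [← Ideal.span_singleton_mul_span_singleton, ← Ideal.span_singleton_mul_span_singleton,
      ← Ideal.span_singleton_pow, ← Ideal.span_singleton_pow, h, h']
    calc span {x} ^ 3 * (b * e ^ 3) = b * (span {x} * e) ^ 3 := by ring
      _ = b * (span {y} * e') ^ 3 := by rw [hxy]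
      _ = _ := by ring
  rw [Ideal.span_singleton_eq_span_singleton] at h4
  obtain ⟨u, hu⟩ := h4
  -- The remaining unit is $\pm 1$, and the sign is absorbed into the cube of `y`.
  rcases isUnit_eq_one_or hc u.isUnit with h5 | h5
  · exact ⟨x, y, hx, hy, by rw [← hu, h5, mul_one]⟩
  · exact ⟨x, -y, hx, neg_ne_zero.2 hy, by rw [h5] at hu; linear_combination -hu⟩

end QuadOrder

/-! ### Split primes and the local behaviour of a generator of $\mathfrak b\,\mathfrak e^3$. -/

namespace QuadOrder

open Ideal

variable {c : ℤ} [IsDedekindDomain (QuadOrder c)]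

/-- If $I$ were prime to $q$, so would be $\bar I$, and hence $I\bar I = (N(I))$, which is contained
in $(q)$. -/
theorem exists_prime_dvd_of_dvd_absNorm (hd : Squarefree (4 * c + 1)) {I : Ideal (QuadOrder c)}
    {q : ℕ} (hq : q.Prime) (hqI : q ∣ absNorm I) :
    ∃ P : Ideal (QuadOrder c), P.IsPrime ∧ P ≠ ⊥ ∧ P ∣ I ∧ ((q : ℤ) : QuadOrder c) ∈ P := by
  have hqR : ((q : ℤ) : QuadOrder c) ≠ 0 := by exact_mod_cast hq.ne_zero
  by_cases htop : I ⊔ span {((q : ℤ) : QuadOrder c)} = ⊤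
  · exfalso
    have hco : IsCoprime I (span {((q : ℤ) : QuadOrder c)}) := Ideal.isCoprime_iff_sup_eq.2 htop
    have hco' : IsCoprime (conj I) (span {((q : ℤ) : QuadOrder c)}) := by
      have h1 : conj (I ⊔ span {((q : ℤ) : QuadOrder c)}) = ⊤ := by rw [htop]; exact Ideal.map_top _
      have h2 := conj_span_singleton (c := c) ((q : ℤ) : QuadOrder c)
      rw [star_intCast] at h2
      rw [conj, Ideal.map_sup] at h1
      change conj I ⊔ conj (span {((q : ℤ) : QuadOrder c)}) = ⊤ at h1
      rw [h2] at h1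
      exact Ideal.isCoprime_iff_sup_eq.2 h1
    have h3 := hco.mul_left hco'
    rw [mul_conj hd, Ideal.isCoprime_iff_sup_eq] at h3
    have h4 : span {((absNorm I : ℤ) : QuadOrder c)} ≤ span {((q : ℤ) : QuadOrder c)} := by
      rw [Ideal.span_singleton_le_span_singleton, intCast_dvd_intCast]
      exact_mod_cast hqI
    rw [sup_eq_right.2 h4, ← Ideal.absNorm_eq_one_iff, absNorm_span_intCast] at h3
    simp only [Int.natAbs_natCast, Nat.pow_eq_one, OfNat.ofNat_ne_zero, or_false] at h3
    exact hq.one_lt.ne' h3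
  · obtain ⟨P, hP, hle⟩ := Ideal.exists_le_maximal _ htop
    have hqP : ((q : ℤ) : QuadOrder c) ∈ P :=
      hle (Ideal.mem_sup_right (Ideal.mem_span_singleton_self _))
    refine ⟨P, hP.isPrime, ?_, Ideal.dvd_iff_le.2 (le_sup_left.trans hle), hqP⟩
    rintro rfl
    exact hqR (by simpa using hqP)

theorem mul_conj_eq_span_of_mem (hd : Squarefree (4 * c + 1)) {P : Ideal (QuadOrder c)} {q : ℕ}
    (hq : q.Prime) (hP : P.IsPrime) (hP0 : P ≠ ⊥) (hne : P ≠ conj P)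
    (hqP : ((q : ℤ) : QuadOrder c) ∈ P) :
    P * conj P = span {((q : ℤ) : QuadOrder c)} ∧ absNorm P = q := by
  have h1 : P ∣ span {((q : ℤ) : QuadOrder c)} := by
    rwa [Ideal.dvd_span_singleton]
  have h2 : conj P ∣ span {((q : ℤ) : QuadOrder c)} := by
    rw [Ideal.dvd_span_singleton, mem_conj_iff, star_intCast]; exact hqP
  have h3 := mul_conj_dvd_of_ne hP hP0 hne h1 h2
  rw [mul_conj hd, Ideal.dvd_span_singleton, Ideal.mem_span_singleton, intCast_dvd_intCast,
    Int.natCast_dvd_natCast] at h3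
  have h4 : absNorm P = q := by
    rcases (Nat.dvd_prime hq).1 h3 with h | h
    · exact absurd (Ideal.absNorm_eq_one_iff.1 h) hP.ne_top
    · exact h
  exact ⟨by rw [mul_conj hd, h4], h4⟩

/-- A rational prime dividing the norm of a conjugation-reduced ideal splits and divides that norm
exactly once. -/
theorem IsConjReduced.exists_prime_factor (hd : Squarefree (4 * c + 1)) {I : Ideal (QuadOrder c)}
    (hI : IsConjReduced I) {q : ℕ} (hq : q.Prime) (hqI : q ∣ absNorm I) :
    ∃ P J : Ideal (QuadOrder c), P.IsPrime ∧ P ≠ ⊥ ∧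
      P * QuadOrder.conj P = span {((q : ℤ) : QuadOrder c)} ∧
      I = P * J ∧ absNorm P = q ∧ ¬ q ∣ absNorm J := by
  obtain ⟨P, hP, hP0, hPI, hqP⟩ := exists_prime_dvd_of_dvd_absNorm hd hq hqI
  obtain ⟨h1, h2⟩ := hI P hP hP0 hPI
  have hne : P ≠ QuadOrder.conj P := fun h => h2 (h ▸ hPI)
  obtain ⟨h3, h4⟩ := mul_conj_eq_span_of_mem hd hq hP hP0 hne hqP
  obtain ⟨J, hJ⟩ := hPI
  refine ⟨P, J, hP, hP0, h3, hJ, h4, fun h5 => ?_⟩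
  obtain ⟨Q, hQ, hQ0, hQJ, hqQ⟩ := exists_prime_dvd_of_dvd_absNorm hd hq h5
  have h6 : P * QuadOrder.conj P ≤ Q := by rwa [h3, Ideal.span_singleton_le_iff_mem]
  have hm := hP.isMaximal hP0
  have hm' := (conj_isPrime hP).isMaximal (conj_ne_bot hP0)
  rcases hQ.mul_le.1 h6 with h | h
  · have : P = Q := hm.eq_of_le hQ.ne_top h
    subst this
    exact h1 (by rw [hJ, sq]; exact mul_dvd_mul_left _ hQJ)
  · have : QuadOrder.conj P = Q := hm'.eq_of_le hQ.ne_top h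
    subst this
    exact h2 (by rw [hJ]; exact hQJ.mul_left _)

theorem norm_eq_of_span_eq (hneg : 4 * c + 1 < 0) {β : QuadOrder c}
    {b e : Ideal (QuadOrder c)} (h : span {β} = b * e ^ 3) :
    β.norm = absNorm b * (absNorm e : ℤ) ^ 3 := by
  have h1 : absNorm (span {β}) = absNorm b * absNorm e ^ 3 := by rw [h, map_mul, map_pow]
  rw [absNorm_span_singleton_eq] at h1
  have h2 := norm_nonneg hneg β
  have h3 : ((β.norm.natAbs : ℕ) : ℤ) = β.norm := Int.natAbs_of_nonneg h2
  rw [← h3, h1]; push_cast; ring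

/-- The arithmetic of a generator of `b * e ^ 3` at a prime dividing the norm of `b`. -/
theorem IsConjReduced.norm_trace (hd : Squarefree (4 * c + 1)) (hneg : 4 * c + 1 < 0)
    {β : QuadOrder c} {b e : Ideal (QuadOrder c)} (h : span {β} = b * e ^ 3)
    (hb : IsConjReduced b) (hco : IsCoprime e (span {((absNorm b : ℤ) : QuadOrder c)}))
    {q : ℕ} (hq : q.Prime) (hqb : q ∣ absNorm b) :
    (q : ℤ) ∣ β.norm ∧ ¬ (q : ℤ) ^ 2 ∣ β.norm ∧ ¬ (q : ℤ) ∣ trace β ∧ ¬ q ∣ absNorm e := by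
  obtain ⟨P, J, hP, hP0, hPP, hPJ, hPq, hqJ⟩ := hb.exists_prime_factor hd hq hqb
  have hqe : ¬ q ∣ absNorm e := by
    intro h1
    obtain ⟨Q, hQ, hQ0, hQe, hqQ⟩ := exists_prime_dvd_of_dvd_absNorm hd hq h1
    apply hQ.ne_top
    rw [Ideal.isCoprime_iff_sup_eq] at hco
    rw [eq_top_iff, ← hco]
    refine sup_le (Ideal.dvd_iff_le.1 hQe) ?_
    rw [Ideal.span_singleton_le_iff_mem]
    obtain ⟨k, hk⟩ := hqb
    rw [hk]; push_cast
    push_cast at hqQ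
    exact Ideal.mul_mem_right _ _ hqQ
  have hN := norm_eq_of_span_eq hneg h
  have hbN : absNorm b = q * absNorm J := by rw [hPJ, map_mul, hPq]
  refine ⟨?_, ?_, ?_, hqe⟩
  · rw [hN, hbN]; push_cast; exact ⟨absNorm J * (absNorm e : ℤ) ^ 3, by ring⟩
  · intro h1
    rw [hN, hbN] at h1
    have h2 : q * q ∣ q * (absNorm J * absNorm e ^ 3) := by
      have : (q : ℤ) ^ 2 = ((q * q : ℕ) : ℤ) := by push_cast; ring
      rw [this] at h1
      rw [← Int.natCast_dvd_natCast]
      convert h1 using 1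
      push_cast; ring
    have h3 := Nat.dvd_of_mul_dvd_mul_left hq.pos h2
    rcases hq.dvd_mul.1 h3 with h4 | h4
    · exact hqJ h4
    · exact hqe (hq.dvd_of_dvd_pow h4)
  -- If $q \mid \mathrm{Tr}(\beta)$, then $\bar\beta = \mathrm{Tr}(\beta) - \beta$ lies in $P$, so
  -- $\bar P$ divides $\mathfrak b\,\mathfrak e^3$. It cannot divide $\mathfrak b$, which is
  -- reduced, nor $\mathfrak e$, whose norm is prime to $q$.
  · intro h1
    have hPb : P ∣ b := ⟨J, hPJ⟩
    have hqP : ((q : ℤ) : QuadOrder c) ∈ P := by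
      have : ((q : ℤ) : QuadOrder c) ∈ P * QuadOrder.conj P := by
        rw [hPP]; exact Ideal.mem_span_singleton_self _
      exact Ideal.mul_le_left this
    have hβP : β ∈ P := by
      have h2 : P ∣ span {β} := by rw [h]; exact hPb.mul_right _
      rwa [Ideal.dvd_span_singleton] at h2
    have hsP : star β ∈ P := by
      have h2 : star β = ((trace β : ℤ) : QuadOrder c) - β := by rw [intCast_trace]; ring
      rw [h2]
      obtain ⟨k, hk⟩ := h1
      rw [hk]; push_cast
      push_cast at hqP
      exact Ideal.sub_mem _ (Ideal.mul_mem_right _ _ hqP) hβP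
    have hβc : QuadOrder.conj P ∣ b * e ^ 3 := by
      rw [← h, Ideal.dvd_span_singleton, mem_conj_iff]; exact hsP
    have hcp : Prime (QuadOrder.conj P) :=
      Ideal.prime_of_isPrime (conj_ne_bot hP0) (conj_isPrime hP)
    rcases hcp.dvd_or_dvd hβc with h2 | h2
    · exact (hb P hP hP0 hPb).2 h2
    · have h3 := hcp.dvd_of_dvd_pow h2
      apply hqe
      rw [← hPq, ← absNorm_conj]
      exact map_dvd absNorm h3

/-- The norm is the index, hence the absolute value of the determinant of a lattice basis; squaring
disposes of the sign. Applied to $\bar{\mathfrak e}$, it supplies the lattice of trace-zero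
integers. -/
theorem exists_pair_of_ideal {I : Ideal (QuadOrder c)} (hI : I ≠ ⊥) :
    ∃ x y : QuadOrder c, x ∈ I ∧ y ∈ I ∧
      (x.re * y.im - y.re * x.im) ^ 2 = (absNorm I : ℤ) ^ 2 := by
  let B := QuadraticAlgebra.basis (R := ℤ) c 1
  let bI := Ideal.selfBasis B I hI
  have h := Ideal.natAbs_det_basis_change B I bI
  refine ⟨bI 0, bI 1, (bI 0).2, (bI 1).2, ?_⟩
  rw [← h, Int.natCast_natAbs, sq_abs]
  congr 1
  rw [Module.Basis.det_apply, Matrix.det_fin_two]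
  simp [Module.Basis.toMatrix_apply, B]

/-- Divisibility properties that make the lattice of cubic resolvents integral. -/
theorem dvd_of_mem_conj (hd : Squarefree (4 * c + 1)) (hneg : 4 * c + 1 < 0) {β : QuadOrder c}
    {b e : Ideal (QuadOrder c)} (h : span {β} = b * e ^ 3) {x : QuadOrder c} (hx : x ∈ conj e) :
    (absNorm e : ℤ) ^ 4 ∣ β.norm * x.norm ∧
      (((absNorm e : ℤ) ^ 6 : ℤ) : QuadOrder c) ∣ β ^ 2 * star β * x ^ 3 := by
  constructor
  · rw [norm_eq_of_span_eq hneg h]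
    have h1 : absNorm (conj e) ∣ absNorm (span {x}) :=
      map_dvd absNorm (Ideal.dvd_span_singleton.2 hx)
    rw [absNorm_conj, absNorm_span_singleton_eq] at h1
    obtain ⟨k, hk⟩ : (absNorm e : ℤ) ∣ x.norm := by
      rwa [Int.natCast_dvd]
    exact ⟨absNorm b * k, by rw [hk]; ring⟩
  · have hβ : span {β} ≤ e ^ 3 := by rw [h]; exact Ideal.mul_le_right
    have hβe : β ∈ e ^ 3 := (Ideal.span_singleton_le_iff_mem _).1 hβ
    have hβc : star β ∈ conj e ^ 3 := by rw [← conj_pow]; exact star_mem_conj hβe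
    -- The exponents balance: $\beta^2 \in \mathfrak e^6$, while $\bar\beta$ and $x^3$ each lie in
    -- $\bar{\mathfrak e}^3$, and $(\mathfrak e\bar{\mathfrak e})^6 = (N(\mathfrak e)^6)$.
    have h1 : β ^ 2 * star β * x ^ 3 ∈ (e ^ 3) ^ 2 * conj e ^ 3 * conj e ^ 3 :=
      Ideal.mul_mem_mul (Ideal.mul_mem_mul (Ideal.pow_mem_pow hβe 2) hβc) (Ideal.pow_mem_pow hx 3)
    have h2 : (e ^ 3) ^ 2 * conj e ^ 3 * conj e ^ 3 =
        span {(((absNorm e : ℤ) ^ 6 : ℤ) : QuadOrder c)} := by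
      calc (e ^ 3) ^ 2 * conj e ^ 3 * conj e ^ 3 = (e * conj e) ^ 6 := by ring
        _ = _ := by rw [mul_conj hd, Ideal.span_singleton_pow]; push_cast; rfl
    rw [h2] at h1
    exact Ideal.mem_span_singleton.1 h1

/-- A prime modulo which `X ^ 2 - X - c` has distinct roots splits. -/
theorem exists_split_prime {p : ℕ} (hp : p.Prime) {r : ℤ}
    (hr : (p : ℤ) ∣ r ^ 2 - r - c) (hr2 : ¬ (p : ℤ) ∣ 2 * r - 1) :
    ∃ P : Ideal (QuadOrder c), P.IsPrime ∧ P ≠ ⊥ ∧ P ≠ conj P ∧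
      P * conj P = span {((p : ℤ) : QuadOrder c)} ∧ absNorm P = p := by
  -- This is $\omega - r$, whose norm is the polynomial's value at $r$. Its trace $1 - 2r$ is prime
  -- to $p$, which makes $(p, z)$ and its conjugate coprime.
  set z : QuadOrder c := ⟨-r, 1⟩ with hz
  set P : Ideal (QuadOrder c) := span {((p : ℤ) : QuadOrder c), z} with hPdef
  have hnz : z.norm = r ^ 2 - r - c := by rw [hz, norm_def]; ring
  have htz : trace z = 1 - 2 * r := by rw [hz, trace_def]; ring
  have hco : IsCoprime (p : ℤ) (2 * r - 1) :=
    (Nat.prime_iff_prime_int.1 hp).coprime_iff_not_dvd.2 hr2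
  obtain ⟨u, v, huv⟩ := hco
  have huv' : (u : QuadOrder c) * ((p : ℤ) : QuadOrder c) - v * (z + star z) = 1 := by
    have h1 : u * (p : ℤ) - v * (1 - 2 * r) = 1 := by linarith
    rw [← intCast_trace, htz, ← Int.cast_mul, ← Int.cast_mul, ← Int.cast_sub, h1, Int.cast_one]
  have hcP : conj P = span {((p : ℤ) : QuadOrder c), star z} := by
    rw [hPdef, conj_span_pair, star_intCast]
  have hmul : P * conj P = span {((p : ℤ) : QuadOrder c)} := by
    rw [hcP, hPdef, Ideal.span_pair_mul_span_pair]
    apply le_antisymm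
    · rw [Ideal.span_le]
      rintro x (rfl | rfl | rfl | rfl)
      · exact Ideal.mem_span_singleton.2 (dvd_mul_right _ _)
      · exact Ideal.mem_span_singleton.2 (dvd_mul_right _ _)
      · exact Ideal.mem_span_singleton.2 (dvd_mul_left _ _)
      · refine Ideal.mem_span_singleton.2 ?_
        rw [← intCast_norm, intCast_dvd_intCast, hnz]; exact hr
    · rw [Ideal.span_singleton_le_iff_mem]
      set q : QuadOrder c := ((p : ℤ) : QuadOrder c) with hq
      have e1 : q = q * q * u - (q * star z + z * q) * v := by
        linear_combination (-q) * huv'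
      have m1 : q * q ∈ span {q * q, q * star z, z * q, z * star z} := Ideal.subset_span (by simp)
      have m2 : q * star z ∈ span {q * q, q * star z, z * q, z * star z} :=
        Ideal.subset_span (by simp)
      have m3 : z * q ∈ span {q * q, q * star z, z * q, z * star z} := Ideal.subset_span (by simp)
      have e2 : q * q * u - (q * star z + z * q) * v ∈
          span {q * q, q * star z, z * q, z * star z} :=
        Ideal.sub_mem _ (Ideal.mul_mem_right _ _ m1)
        (Ideal.mul_mem_right _ _ (Ideal.add_mem _ m2 m3))
      rwa [← e1] at e2
  have hnorm : absNorm P = p := by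
    have h1 : absNorm P ^ 2 = p ^ 2 := by
      rw [sq, ← absNorm_conj P, absNorm_conj P]
      nth_rewrite 2 [← absNorm_conj P]
      rw [← map_mul, hmul, absNorm_span_intCast, Int.natAbs_natCast]
    exact Nat.pow_left_injective two_ne_zero h1
  have hprime : P.IsPrime := Ideal.isPrime_of_irreducible_absNorm (by rw [hnorm]; exact hp)
  refine ⟨P, hprime, ?_, ?_, hmul, hnorm⟩
  · intro h
    rw [h, Ideal.absNorm_bot] at hnorm
    exact hp.ne_zero hnorm.symm
  · intro h
    apply hprime.ne_top
    rw [Ideal.eq_top_iff_one, ← huv']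
    have m1 : ((p : ℤ) : QuadOrder c) ∈ P := Ideal.subset_span (by simp)
    have m2 : z ∈ P := Ideal.subset_span (by simp)
    have m3 : star z ∈ P := by rw [h]; exact star_mem_conj m2
    exact Ideal.sub_mem _ (Ideal.mul_mem_left _ _ m1)
      (Ideal.mul_mem_left _ _ (Ideal.add_mem _ m2 m3))

end QuadOrder

/-! ### Trace-zero elements of a cubic field and their discriminants. -/

namespace CubicField

variable {K : Type*} [Field K] [CharZero K]

/-- In a cubic field, an irrational element satisfies no quadratic equation. -/
theorem coeffs_eq_zero (h3 : Module.finrank ℚ K = 3) {θ : K} (hθ : ∀ r : ℚ, (r : K) ≠ θ)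
    {p q r : ℚ} (h : (p : K) + q * θ + r * θ ^ 2 = 0) : p = 0 ∧ q = 0 ∧ r = 0 := by
  have : FiniteDimensional ℚ K := Module.finite_of_finrank_pos (by omega)
  have hint : IsIntegral ℚ θ := IsIntegral.of_finite ℚ θ
  have h2 : 2 ≤ (minpoly ℚ θ).natDegree := by
    rw [minpoly.two_le_natDegree_iff hint]
    rintro ⟨r, hr⟩
    exact hθ r (by simpa using hr)
  have hdvd : (minpoly ℚ θ).natDegree ∣ 3 := h3 ▸ minpoly.degree_dvd hint
  have h3' : (minpoly ℚ θ).natDegree = 3 := by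
    rcases (Nat.dvd_prime Nat.prime_three).1 hdvd with h | h <;> omega
  have hP : aeval θ (C p + C q * X + C r * X ^ 2) = 0 := by
    simpa [eq_ratCast] using h
  have hdeg : (C p + C q * X + C r * X ^ 2 : ℚ[X]).natDegree < 3 := by
    have : (C p + C q * X + C r * X ^ 2 : ℚ[X]).natDegree ≤ 2 := by compute_degree
    omega
  have h0 : (C p + C q * X + C r * X ^ 2 : ℚ[X]) = 0 := by
    by_contra hne
    have := Polynomial.natDegree_le_of_dvd (minpoly.dvd ℚ θ hP) hne
    omega
  refine ⟨?_, ?_, ?_⟩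
  · simpa [coeff_X, coeff_C] using congrArg (fun f => coeff f 0) h0
  · simpa [coeff_X, coeff_C, coeff_X_pow] using congrArg (fun f => coeff f 1) h0
  · simpa [coeff_X, coeff_C, coeff_X_pow] using congrArg (fun f => coeff f 2) h0

/-- The basis `1, θ, θ ^ 2` of a cubic field. -/
theorem exists_basis (h3 : Module.finrank ℚ K = 3) {θ : K} (hθ : ∀ r : ℚ, (r : K) ≠ θ) :
    ∃ b : Module.Basis (Fin 3) ℚ K, ⇑b = ![1, θ, θ ^ 2] := by
  have hli : LinearIndependent ℚ ![1, θ, θ ^ 2] := by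
    rw [Fintype.linearIndependent_iff]
    intro g hg
    rw [Fin.sum_univ_three] at hg
    have h := coeffs_eq_zero h3 hθ (p := g 0) (q := g 1) (r := g 2)
      (by simpa [Algebra.smul_def] using hg)
    intro i
    fin_cases i
    · exact h.1
    · exact h.2.1
    · exact h.2.2
  exact ⟨basisOfLinearIndependentOfCardEqFinrank hli (by simp [h3]), by simp⟩

theorem exists_coords (h3 : Module.finrank ℚ K = 3) {θ : K} (hθ : ∀ r : ℚ, (r : K) ≠ θ) (x : K) :
    ∃ p q r : ℚ, x = p + q * θ + r * θ ^ 2 := by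
  obtain ⟨b, hb⟩ := exists_basis h3 hθ
  refine ⟨b.repr x 0, b.repr x 1, b.repr x 2, ?_⟩
  conv_lhs => rw [← b.sum_repr x]
  rw [Fin.sum_univ_three, hb]
  simp [Algebra.smul_def]

theorem trace_eq (h3 : Module.finrank ℚ K = 3) {θ : K} (hθ : ∀ r : ℚ, (r : K) ≠ θ) {A B : ℚ}
    (h : θ ^ 3 = 3 * A * θ + B) (p q r : ℚ) :
    Algebra.trace ℚ K (p + q * θ + r * θ ^ 2) = 3 * p + 6 * A * r := by
  obtain ⟨b, hb⟩ := exists_basis h3 hθ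
  have hrepr : ∀ p q r : ℚ, b.repr (p + q * θ + r * θ ^ 2) =
      Finsupp.equivFunOnFinite.symm ![p, q, r] := by
    intro p q r
    have h0 : (p : K) + q * θ + r * θ ^ 2 = ∑ i, ![p, q, r] i • b i := by
      rw [Fin.sum_univ_three, hb]; simp [Algebra.smul_def]
    rw [h0]
    ext i
    rw [b.repr_sum_self]
    rfl
  have b0 : b 0 = 1 := by rw [hb]; rfl
  have b1 : b 1 = θ := by rw [hb]; rfl
  have b2 : b 2 = θ ^ 2 := by rw [hb]; rfl
  rw [Algebra.trace_eq_matrix_trace b, Matrix.trace_fin_three, Algebra.leftMulMatrix_eq_repr_mul,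
    Algebra.leftMulMatrix_eq_repr_mul, Algebra.leftMulMatrix_eq_repr_mul, b0, b1, b2]
  have e1 : ((p : K) + q * θ + r * θ ^ 2) * θ =
      ((r * B : ℚ) : K) + ((p + 3 * A * r : ℚ) : K) * θ + (q : K) * θ ^ 2 := by
    push_cast; linear_combination (r : K) * h
  have e2 : ((p : K) + q * θ + r * θ ^ 2) * θ ^ 2 =
      ((q * B : ℚ) : K) + ((3 * A * q + r * B : ℚ) : K) * θ +
        ((p + 3 * A * r : ℚ) : K) * θ ^ 2 := by
    push_cast; linear_combination ((q : K) + r * θ) * h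
  rw [mul_one, e1, e2, hrepr, hrepr, hrepr]
  simp
  ring

/-- This is the discriminant of $X^3 - 3AX - B$. The factor $3$ is Cardano's normalization: for
$\theta = u + u'$ one has $A = uu'$ and $B = u^3 + u'^3$. -/
theorem discr_powers (h3 : Module.finrank ℚ K = 3) {θ : K} (hθ : ∀ r : ℚ, (r : K) ≠ θ) {A B : ℚ}
    (h : θ ^ 3 = 3 * A * θ + B) :
    Algebra.discr ℚ ![1, θ, θ ^ 2] = -27 * (B ^ 2 - 4 * A ^ 3) := by
  have tr := trace_eq h3 hθ h
  have t0 : Algebra.trace ℚ K 1 = 3 := by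
    have := tr 1 0 0; simpa using this
  have t1 : Algebra.trace ℚ K θ = 0 := by
    have := tr 0 1 0; simpa using this
  have t2 : Algebra.trace ℚ K (θ ^ 2) = 6 * A := by
    have := tr 0 0 1; simpa using this
  have t3 : Algebra.trace ℚ K (θ ^ 3) = 3 * B := by
    have := tr B (3 * A) 0
    rw [← show θ ^ 3 = (B : K) + ((3 * A : ℚ) : K) * θ + ((0 : ℚ) : K) * θ ^ 2 by
      rw [h]; push_cast; ring] at this
    rw [this]; ring
  have t4 : Algebra.trace ℚ K (θ ^ 4) = 18 * A ^ 2 := by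
    have := tr 0 B (3 * A)
    rw [← show θ ^ 4 = ((0 : ℚ) : K) + (B : K) * θ + ((3 * A : ℚ) : K) * θ ^ 2 by
      push_cast; linear_combination θ * h] at this
    rw [this]; ring
  rw [Algebra.discr_def, Matrix.det_fin_three]
  simp only [Algebra.traceMatrix_apply, Algebra.traceForm_apply, Matrix.cons_val_zero,
    Matrix.cons_val_one, Matrix.cons_val, one_mul, mul_one]
  rw [show θ * θ = θ ^ 2 by ring, show θ * θ ^ 2 = θ ^ 3 by ring, show θ ^ 2 * θ = θ ^ 3 by ring,
    show θ ^ 2 * θ ^ 2 = θ ^ 4 by ring, t0, t1, t2, t3, t4]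
  ring

/-- The trace-zero element attached to `x + y √d`, where `θ` is a root of `X ^ 3 - 3 A X - B` and
`C √d` is a square root of `B ^ 2 - 4 A ^ 3`. -/
def resolvent (A B C : ℚ) (θ : K) (x y : ℚ) : K :=
  x * θ + y * ((B * θ - 2 * A * θ ^ 2 + 4 * A ^ 2) / C)

/-- With $\theta = u + u'$, $uu' = A$ and $u^3 - u'^3 = C\sqrt d$, the element is $\omega u +
\bar\omega u'$ for $\omega = x + y\sqrt d$; indeed $C\sqrt d\,(u - u') = B\theta - 2A\theta^2 +
4A^2$. So $A$ is multiplied by $N(\omega)$, and the constant term becomes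
$\mathrm{Tr}(\omega^3u^3)$. -/
theorem resolvent_cube {A B C d : ℚ} (hC : C ≠ 0) (hd : C ^ 2 * d = B ^ 2 - 4 * A ^ 3) {θ : K}
    (h : θ ^ 3 = 3 * A * θ + B) (x y : ℚ) :
    resolvent A B C θ x y ^ 3 =
      3 * ((A * (x ^ 2 - d * y ^ 2) : ℚ) : K) * resolvent A B C θ x y +
      ((B * (x ^ 3 + 3 * x * y ^ 2 * d) + C * d * (3 * x ^ 2 * y + y ^ 3 * d) : ℚ) : K) := by
  have hC' : (C : K) ≠ 0 := by exact_mod_cast hC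
  have hd' : (d : K) = (B ^ 2 - 4 * A ^ 3) / C ^ 2 := by
    rw [eq_div_iff (pow_ne_zero 2 hC'), mul_comm]; exact_mod_cast hd
  have hB : (B : K) = θ ^ 3 - 3 * A * θ := by rw [h]; ring
  unfold resolvent
  push_cast
  rw [hd', hB]
  field_simp
  ring

theorem resolvent_eq {A B C : ℚ} {θ : K} (x y : ℚ) :
    resolvent A B C θ x y = ((4 * A ^ 2 * y / C : ℚ) : K) + ((x + y * B / C : ℚ) : K) * θ +
      ((-(2 * A * y / C) : ℚ) : K) * θ ^ 2 := by
  unfold resolvent; push_cast; ring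

theorem discr_resolvent (h3 : Module.finrank ℚ K = 3) {θ : K} (hθ : ∀ r : ℚ, (r : K) ≠ θ)
    {A B C d : ℚ} (hC : C ≠ 0) (hd : C ^ 2 * d = B ^ 2 - 4 * A ^ 3)
    (h : θ ^ 3 = 3 * A * θ + B) (x₁ y₁ x₂ y₂ : ℚ) :
    Algebra.discr ℚ ![1, resolvent A B C θ x₁ y₁, resolvent A B C θ x₂ y₂] =
      -27 * d * (2 * A * (x₁ * y₂ - x₂ * y₁)) ^ 2 := by
  set P : Matrix (Fin 3) (Fin 3) ℚ := !![1, 0, 0;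
    4 * A ^ 2 * y₁ / C, x₁ + y₁ * B / C, -(2 * A * y₁ / C);
    4 * A ^ 2 * y₂ / C, x₂ + y₂ * B / C, -(2 * A * y₂ / C)] with hP
  have hv : ![1, resolvent A B C θ x₁ y₁, resolvent A B C θ x₂ y₂] =
      Matrix.mulVec (P.map (algebraMap ℚ K)) ![1, θ, θ ^ 2] := by
    ext i
    fin_cases i <;>
    simp [hP, Matrix.mulVec, dotProduct, Fin.sum_univ_three, resolvent_eq]
  have hdet : P.det = -(2 * A / C) * (x₁ * y₂ - x₂ * y₁) := by
    rw [hP, Matrix.det_fin_three]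
    simp only [Matrix.of_apply, Matrix.cons_val_zero, Matrix.cons_val_one, Matrix.cons_val]
    field_simp
    ring
  rw [hv, Algebra.discr_of_matrix_mulVec, hdet, discr_powers h3 hθ h, ← hd]
  field_simp

/-- A vanishing discriminant forces $X^3 - 3AX - B = (X - 2a)(X + a)^2$ with $a$ rational. -/
theorem ne_zero_of_cubic {θ : K} (hθ : ∀ r : ℚ, (r : K) ≠ θ)
    {A B : ℚ} (h : θ ^ 3 = 3 * A * θ + B) : B ^ 2 - 4 * A ^ 3 ≠ 0 := by
  intro h0
  by_cases hA : A = 0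
  · subst hA
    have hB : B = 0 := by simpa using h0
    subst hB
    have : θ = 0 := by simpa using h
    exact hθ 0 (by simp [this])
  · set a : ℚ := B / (2 * A) with ha
    have hA2 : A = a ^ 2 := by
      rw [ha]; field_simp; linear_combination -h0
    have hB : B = 2 * a ^ 3 := by
      have : B = 2 * A * a := by rw [ha]; field_simp
      rw [this, hA2]; ring
    have h1 : (θ - 2 * a) * (θ + a) ^ 2 = 0 := by
      rw [hA2, hB] at h
      push_cast at h
      linear_combination h
    rcases mul_eq_zero.1 h1 with h2 | h2
    · exact hθ (2 * a) (by push_cast; linear_combination -h2)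
    · rw [pow_eq_zero_iff two_ne_zero] at h2
      exact hθ (-a) (by push_cast; linear_combination -h2)

theorem resolvent_irrational (h3 : Module.finrank ℚ K = 3) {θ : K} (hθ : ∀ r : ℚ, (r : K) ≠ θ)
    {A B C : ℚ} (hA : A ≠ 0) (hC : C ≠ 0) {x y : ℚ} (hxy : x ≠ 0 ∨ y ≠ 0) (r : ℚ) :
    (r : K) ≠ resolvent A B C θ x y := by
  intro hr
  rw [resolvent_eq] at hr
  obtain ⟨-, h1, h2⟩ := coeffs_eq_zero h3 hθ (p := 4 * A ^ 2 * y / C - r) (q := x + y * B / C)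
    (r := -(2 * A * y / C)) (by push_cast at hr ⊢; linear_combination -hr)
  have hy : y = 0 := by
    field_simp at h2
    simpa [hA, hC] using h2
  subst hy
  have hx : x = 0 := by simpa using h1
  rcases hxy with h | h <;> contradiction

/-- Every trace-zero element is a resolvent. -/
theorem exists_eq_resolvent (h3 : Module.finrank ℚ K = 3) {θ φ : K} (hθ : ∀ r : ℚ, (r : K) ≠ θ)
    (hφ : ∀ r : ℚ, (r : K) ≠ φ) {A B A' B' C : ℚ} (hA : A ≠ 0) (hC : C ≠ 0)
    (h : θ ^ 3 = 3 * A * θ + B) (h' : φ ^ 3 = 3 * A' * φ + B') :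
    ∃ x y : ℚ, φ = resolvent A B C θ x y := by
  obtain ⟨p, q, r, hpqr⟩ := exists_coords h3 hθ φ
  have ht : 3 * p + 6 * A * r = 0 := by
    rw [← trace_eq h3 hθ h p q r, ← hpqr]
    have := trace_eq h3 hφ h' 0 1 0
    simpa using this
  have hC' : (C : K) ≠ 0 := by exact_mod_cast hC
  have hA' : (A : K) ≠ 0 := by exact_mod_cast hA
  refine ⟨q + r * B / (2 * A), -(r * C / (2 * A)), ?_⟩
  have hp : p = -2 * A * r := by linarith
  rw [hpqr, hp, resolvent]
  push_cast
  field_simp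
  ring

end CubicField

/-! ### Integral bases and the index of $\mathbb{Z}[\theta]$ at an Eisenstein prime. -/

namespace CubicField

theorem norm_eq {K : Type*} [Field K] [CharZero K] (h3 : Module.finrank ℚ K = 3) {θ : K}
    (hθ : ∀ r : ℚ, (r : K) ≠ θ) {A B : ℚ} (h : θ ^ 3 = 3 * A * θ + B) :
    Algebra.norm ℚ θ = B := by
  obtain ⟨b, hb⟩ := exists_basis h3 hθ
  have hrepr : ∀ p q r : ℚ, b.repr (p + q * θ + r * θ ^ 2) =
      Finsupp.equivFunOnFinite.symm ![p, q, r] := by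
    intro p q r
    have h0 : (p : K) + q * θ + r * θ ^ 2 = ∑ i, ![p, q, r] i • b i := by
      rw [Fin.sum_univ_three, hb]; simp [Algebra.smul_def]
    rw [h0]
    ext i
    rw [b.repr_sum_self]
    rfl
  have b0 : b 0 = 1 := by rw [hb]; rfl
  have b1 : b 1 = θ := by rw [hb]; rfl
  have b2 : b 2 = θ ^ 2 := by rw [hb]; rfl
  have e0 : θ * 1 = ((0 : ℚ) : K) + ((1 : ℚ) : K) * θ + ((0 : ℚ) : K) * θ ^ 2 := by simp
  have e1 : θ * θ = ((0 : ℚ) : K) + ((0 : ℚ) : K) * θ + ((1 : ℚ) : K) * θ ^ 2 := by simp [sq]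
  have e2 : θ * θ ^ 2 = (B : K) + ((3 * A : ℚ) : K) * θ + ((0 : ℚ) : K) * θ ^ 2 := by
    push_cast; linear_combination h
  rw [Algebra.norm_eq_matrix_det b, Matrix.det_fin_three]
  simp only [Algebra.leftMulMatrix_eq_repr_mul, b0, b1, b2]
  rw [e0, e1, e2, hrepr, hrepr, hrepr]
  simp

variable {K : Type*} [Field K] [NumberField K]

theorem exists_integral_basis (h3 : Module.finrank ℚ K = 3) :
    Nonempty (Module.Basis (Fin 3) ℤ (𝓞 K)) := by
  have hr : Module.finrank ℤ (𝓞 K) = 3 := by rw [NumberField.RingOfIntegers.rank, h3]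
  exact ⟨(Module.finBasisOfFinrankEq ℤ (𝓞 K) hr)⟩

theorem coe_discr_eq (v : Fin 3 → 𝓞 K) :
    ((Algebra.discr ℤ v : ℤ) : ℚ) = Algebra.discr ℚ (fun i => (v i : K)) := by
  rw [Algebra.discr_def, Algebra.discr_def, ← eq_intCast (Int.castRingHom ℚ), RingHom.map_det]
  congr 1
  ext i j
  simp only [RingHom.mapMatrix_apply, Matrix.map_apply, Algebra.traceMatrix_apply,
    Algebra.traceForm_apply, eq_intCast]
  rw [Algebra.coe_trace_int]
  rfl

/-- The discriminant of three integers of a cubic field. -/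
theorem discr_eq_det_sq_mul (b : Module.Basis (Fin 3) ℤ (𝓞 K)) (v : Fin 3 → 𝓞 K) :
    Algebra.discr ℚ (fun i => (v i : K)) =
      (((b.toMatrix v).det ^ 2 * NumberField.discr K : ℤ) : ℚ) := by
  rw [← coe_discr_eq, ← NumberField.discr_eq_discr K b, ← Algebra.discr_of_matrix_vecMul]
  congr 2
  exact (Module.Basis.toMatrix_map_vecMul b v).symm

theorem exists_discr_eq_sq_mul (h3 : Module.finrank ℚ K = 3) {w₁ w₂ : K} (h₁ : IsIntegral ℤ w₁)
    (h₂ : IsIntegral ℤ w₂) :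
    ∃ k : ℤ, Algebra.discr ℚ ![1, w₁, w₂] = ((k ^ 2 * NumberField.discr K : ℤ) : ℚ) := by
  obtain ⟨b⟩ := exists_integral_basis h3
  refine ⟨_, (congrArg (Algebra.discr ℚ) ?_).trans (discr_eq_det_sq_mul b ![1, ⟨w₁, h₁⟩, ⟨w₂, h₂⟩])⟩
  ext i
  fin_cases i
  · simp
  · rfl
  · rfl

/-- Taking norms gives $q^3N(y) = v^3B^2$. As $q$ divides $B$ exactly once, it must divide $v$. -/
theorem dvd_of_isIntegral_div (h3 : Module.finrank ℚ K = 3) {θ : K} (hθ : ∀ r : ℚ, (r : K) ≠ θ)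
    {A B : ℤ} (h : θ ^ 3 = 3 * A * θ + B) {q : ℕ} (hq : q.Prime) (hB : (q : ℤ) ∣ B)
    (hB2 : ¬ (q : ℤ) ^ 2 ∣ B) {v : ℤ} {y : 𝓞 K} (hy : (q : K) * y = v * θ ^ 2) : (q : ℤ) ∣ v := by
  have hN : Algebra.norm ℚ θ = (B : ℚ) := norm_eq h3 hθ (A := A) (by push_cast; exact h)
  have h1 := congrArg (Algebra.norm ℚ) hy
  rw [map_mul, map_mul, map_pow, hN] at h1
  have hq1 : Algebra.norm ℚ (q : K) = (q : ℚ) ^ 3 := by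
    have := Algebra.norm_algebraMap (S := K) (q : ℚ)
    rw [h3] at this; simpa using this
  have hv1 : Algebra.norm ℚ (v : K) = (v : ℚ) ^ 3 := by
    have := Algebra.norm_algebraMap (S := K) (v : ℚ)
    rw [h3] at this; simpa using this
  rw [hq1, hv1, ← Algebra.coe_norm_int] at h1
  have h2 : (q : ℤ) ^ 3 * Algebra.norm ℤ y = v ^ 3 * B ^ 2 := by exact_mod_cast h1
  obtain ⟨B', rfl⟩ := hB
  have hqp : Prime (q : ℤ) := Nat.prime_iff_prime_int.1 hq
  have h4 : ¬ (q : ℤ) ∣ B' := fun ⟨k, hk⟩ => hB2 ⟨k, by rw [hk]; ring⟩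
  have h5 : (q : ℤ) * Algebra.norm ℤ y = v ^ 3 * B' ^ 2 := by
    have h6 : (q : ℤ) ^ 2 ≠ 0 := pow_ne_zero 2 hqp.ne_zero
    apply mul_left_cancel₀ h6
    linear_combination h2
  rcases hqp.dvd_or_dvd (Dvd.intro _ h5) with h6 | h6
  · exact hqp.dvd_of_dvd_pow h6
  · exact absurd (hqp.dvd_of_dvd_pow h6) h4

/-- The index of `ℤ[θ]` in the ring of integers is prime to `q` if the polynomial
`X ^ 3 - 3 A X - B` is Eisenstein at `q`. -/
theorem not_dvd_index (h3 : Module.finrank ℚ K = 3) {θ : K} (hθ : ∀ r : ℚ, (r : K) ≠ θ)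
    {A B : ℤ} (h : θ ^ 3 = 3 * A * θ + B) {q : ℕ} (hq : q.Prime) (hA : (q : ℤ) ∣ A)
    (hB : (q : ℤ) ∣ B) (hB2 : ¬ (q : ℤ) ^ 2 ∣ B) :
    ∃ j : ℤ, -27 * (B ^ 2 - 4 * A ^ 3) = j ^ 2 * NumberField.discr K ∧ ¬ (q : ℤ) ∣ j := by
  obtain ⟨b⟩ := exists_integral_basis h3
  have hint : IsIntegral ℤ θ := by
    refine ⟨X ^ 3 - C (3 * A) * X - C B, by monicity!, ?_⟩
    rw [eval₂_sub, eval₂_sub, eval₂_mul, eval₂_pow, eval₂_X, eval₂_C, eval₂_C, h]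
    simp
  set t : 𝓞 K := ⟨θ, hint⟩ with ht
  have htθ : (t : K) = θ := rfl
  set v : Fin 3 → 𝓞 K := ![1, t, t ^ 2] with hv
  have hcoe : (fun i => (v i : K)) = ![1, θ, θ ^ 2] := by
    ext i
    fin_cases i
    · simp [hv]
    · rfl
    · simp [hv, htθ]
  refine ⟨(b.toMatrix v).det, ?_, ?_⟩
  · have h1 := discr_eq_det_sq_mul b v
    rw [hcoe, discr_powers h3 hθ (A := A) (B := B) (by push_cast; exact h)] at h1
    exact_mod_cast h1
  · intro hdvd
    have : Fact q.Prime := ⟨hq⟩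
    -- If $q$ divides the index, some $u_0 + u_1\theta + u_2\theta^2$ with coefficients not all
    -- divisible by $q$ is $q$ times an integer of $K$.
    have hdet : ((b.toMatrix v).transpose.map (Int.castRingHom (ZMod q))).det = 0 := by
      rw [← RingHom.mapMatrix_apply, ← RingHom.map_det, Matrix.det_transpose, eq_intCast,
        ZMod.intCast_zmod_eq_zero_iff_dvd]
      exact hdvd
    obtain ⟨w, hw0, hw⟩ := Matrix.exists_vecMul_eq_zero_iff.2 hdet
    have hlift : ∀ x : ZMod q, ∃ n : ℤ, (n : ZMod q) = x := ZMod.intCast_surjective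
    choose lift hlift using hlift
    set u : Fin 3 → ℤ := fun i => lift (w i) with hu
    have hcol : ∀ j, ∃ k : ℤ, ∑ i, u i * b.repr (v i) j = q * k := by
      intro j
      have h2 := congrFun hw j
      have h3 : ((∑ i, u i * b.repr (v i) j : ℤ) : ZMod q) = 0 := by
        push_cast
        simp only [hu, hlift]
        simpa [Matrix.vecMul, dotProduct, Module.Basis.toMatrix_apply] using h2
      rw [ZMod.intCast_zmod_eq_zero_iff_dvd] at h3
      exact h3
    choose k hk using hcol
    have hsum : ∑ i, u i • v i = (q : ℤ) • ∑ j, k j • b j := by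
      calc ∑ i, u i • v i = ∑ i, u i • ∑ j, b.repr (v i) j • b j := by simp_rw [b.sum_repr]
        _ = ∑ j, (∑ i, u i * b.repr (v i) j) • b j := by
          simp_rw [Finset.smul_sum, Finset.sum_smul, smul_smul]
          exact Finset.sum_comm
        _ = _ := by simp_rw [hk, Finset.smul_sum, smul_smul]
    set x : 𝓞 K := ∑ j, k j • b j with hx
    have hsum' : (u 0 : 𝓞 K) + u 1 * t + u 2 * t ^ 2 = q * x := by
      rw [Fin.sum_univ_three] at hsum
      simpa [hv] using hsum
    obtain ⟨A', hA'⟩ := hA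
    obtain ⟨B', hB'⟩ := id hB
    have ht3 : t ^ 3 = q * (3 * A' * t + B') := by
      apply NumberField.RingOfIntegers.ext
      show algebraMap (𝓞 K) K _ = algebraMap (𝓞 K) K _
      simp only [map_pow, map_mul, map_add, map_natCast, map_intCast, map_ofNat]
      show θ ^ 3 = (q : K) * (3 * A' * θ + B')
      rw [h, hA', hB']; push_cast; ring
    set s : 𝓞 K := 3 * A' * t + B' with hs
    have key : ∀ (c : ℤ) (y : 𝓞 K), (c : 𝓞 K) * t ^ 2 = q * y → (q : ℤ) ∣ c := by
      intro c y hcy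
      apply dvd_of_isIntegral_div h3 hθ h hq hB hB2 (y := y)
      have := congrArg (algebraMap (𝓞 K) K) hcy
      simp only [map_pow, map_mul, map_natCast, map_intCast] at this
      exact this.symm
    -- Since $q \mid \theta^3$, multiplication by $\theta^2$ isolates $u_0\theta^2$ modulo $q$. With
    -- $u_0$ removed, multiplication by $\theta$ isolates $u_1$, and then $u_2$ is left.
    have d0 : (q : ℤ) ∣ u 0 := key _ (x * t ^ 2 - u 1 * s - u 2 * s * t) (by
      linear_combination t ^ 2 * hsum' - ((u 1 : 𝓞 K) + u 2 * t) * ht3)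
    obtain ⟨u0, hu0⟩ := id d0
    have hu0' : (u 0 : 𝓞 K) = q * u0 := by rw [hu0]; push_cast; ring
    have d1 : (q : ℤ) ∣ u 1 := key _ (x * t - u0 * t - u 2 * s) (by
      linear_combination t * hsum' - (u 2 : 𝓞 K) * ht3 - t * hu0')
    obtain ⟨u1, hu1⟩ := id d1
    have hu1' : (u 1 : 𝓞 K) = q * u1 := by rw [hu1]; push_cast; ring
    have d2 : (q : ℤ) ∣ u 2 := key _ (x - u0 - u1 * t) (by
      linear_combination hsum' - hu0' - t * hu1')
    apply hw0
    ext i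
    have : (q : ℤ) ∣ u i := by
      fin_cases i
      · exact d0
      · exact d1
      · exact d2
    rw [← ZMod.intCast_zmod_eq_zero_iff_dvd] at this
    rw [← hlift (w i)]
    exact this

end CubicField

/-! ### Dependence of the cubic field on $\beta$: cubes, rational factors and conjugation. -/

namespace QuadOrder

variable {c : ℤ}

theorem trace_intCast_mul (k : ℤ) (z : QuadOrder c) :
    trace ((k : QuadOrder c) * z) = k * trace z := by
  simp only [trace_def, re_mul, im_mul, re_intCast, im_intCast, Int.cast_id]; ring

theorem norm_intCast_mul (k : ℤ) (z : QuadOrder c) :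
    ((k : QuadOrder c) * z).norm = k ^ 2 * z.norm := by
  rw [map_mul, norm_intCast, Int.cast_id]

theorem sq_mul_star (β : QuadOrder c) : β ^ 2 * star β = (β.norm : QuadOrder c) * β := by
  rw [intCast_norm]; ring

theorem norm_sq_mul_star (β : QuadOrder c) : (β ^ 2 * star β).norm = β.norm ^ 3 := by
  rw [map_mul, map_pow, QuadraticAlgebra.norm_star]; ring

theorem trace_sq_mul_star (β : QuadOrder c) : trace (β ^ 2 * star β) = β.norm * trace β := by
  rw [sq_mul_star, trace_intCast_mul]

theorem trace_sq_sub_four_mul_norm (z : QuadOrder c) :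
    trace z ^ 2 - 4 * z.norm = (4 * c + 1) * z.im ^ 2 := by
  rw [trace_def, norm_def]; ring

/-- Both are roots of the same quadratic polynomial over $\mathbb{Z}$. -/
theorem eq_or_eq_star (hneg : 4 * c + 1 < 0) {x y : QuadOrder c} (ht : trace x = trace y)
    (hn : x.norm = y.norm) : x = y ∨ x = star y := by
  have h1 := trace_sq_sub_four_mul_norm x
  have h2 := trace_sq_sub_four_mul_norm y
  rw [ht, hn, h2] at h1
  have h3 := mul_left_cancel₀ hneg.ne h1
  rw [trace_def, trace_def] at ht
  rcases sq_eq_sq_iff_eq_or_eq_neg.1 h3 with h | h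
  · left; ext
    · omega
    · exact h.symm
  · right; ext
    · simp; omega
    · simp; omega

end QuadOrder

namespace CubicField

open QuadOrder

variable {c : ℤ} {K : Type*} [Field K]

/-- `K` contains an irrational root of the cubic resolvent polynomial
`X ^ 3 - 3 N(β) X - N(β) Tr(β)`. -/
def HasCubicRoot (K : Type*) [Field K] (β : QuadOrder c) : Prop :=
  ∃ θ : K, (∀ r : ℚ, (r : K) ≠ θ) ∧
    θ ^ 3 = 3 * ((β.norm : ℤ) : K) * θ + ((β.norm * trace β : ℤ) : K)

theorem HasCubicRoot.star {β : QuadOrder c} (h : HasCubicRoot K β) : HasCubicRoot K (star β) := by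
  unfold HasCubicRoot
  rw [QuadraticAlgebra.norm_star, trace_star]
  exact h

variable [CharZero K]

/-- A rational factor $\rho$ multiplies $\beta^2\bar\beta$ by the cube $\rho^3$, hence the root by
$\rho$. -/
theorem HasCubicRoot.scale {β β' : QuadOrder c} {r s : ℤ} (hr : r ≠ 0) (hs : s ≠ 0)
    (hβ : (s : QuadOrder c) * β' = r * β) (h : HasCubicRoot K β) : HasCubicRoot K β' := by
  obtain ⟨θ, hθ, h⟩ := h
  have hn := congrArg QuadraticAlgebra.norm hβ
  have ht := congrArg trace hβ
  rw [norm_intCast_mul, norm_intCast_mul] at hn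
  rw [trace_intCast_mul, trace_intCast_mul] at ht
  have hr' : (r : K) ≠ 0 := by exact_mod_cast hr
  have hs' : (s : K) ≠ 0 := by exact_mod_cast hs
  refine ⟨r / s * θ, fun x hx => hθ (s / r * x) ?_, ?_⟩
  · push_cast; rw [hx]; field_simp
  · have hn' : (s : K) ^ 2 * (β'.norm : ℤ) = r ^ 2 * (β.norm : ℤ) := by exact_mod_cast hn
    have ht' : (s : K) * (trace β' : ℤ) = r * (trace β : ℤ) := by exact_mod_cast ht
    push_cast at h ⊢
    have e1 : ((β'.norm : ℤ) : K) = r ^ 2 * (β.norm : ℤ) / s ^ 2 := by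
      rw [eq_div_iff (pow_ne_zero 2 hs'), ← hn']; ring
    have e2 : ((trace β' : ℤ) : K) = r * (trace β : ℤ) / s := by
      rw [eq_div_iff hs', ← ht']; ring
    rw [e1, e2, mul_pow, h]
    field_simp

section Twist

variable {α ξ : QuadOrder c} {A : ℤ} {θ : K}

/-- The trace-zero element `ω u + ω' u'`, with `u, u'` the cube roots of `α, α'` and
`ω = ξ / k`. -/
def twist (α : QuadOrder c) (A : ℤ) (θ : K) (ξ : QuadOrder c) (k : ℤ) : K :=
  resolvent A (trace α : ℤ) (α.im : ℤ) θ ((2 * ξ.re + ξ.im : ℤ) / (2 * k)) (ξ.im / (2 * k))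

theorem im_ne_zero_of_root (hα : α.norm = A ^ 3) (hθ : ∀ r : ℚ, (r : K) ≠ θ)
    (h : θ ^ 3 = 3 * (A : K) * θ + ((trace α : ℤ) : K)) : α.im ≠ 0 := by
  intro h0
  have h1 := trace_sq_sub_four_mul_norm α
  rw [h0, hα] at h1
  refine ne_zero_of_cubic hθ (A := A) (B := (trace α : ℤ)) (by push_cast; exact h) ?_
  have : ((trace α ^ 2 - 4 * A ^ 3 : ℤ) : ℚ) = 0 := by rw [h1]; simp
  push_cast at this
  exact this

theorem resolvent_hyp (hα : α.norm = A ^ 3) :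
    ((α.im : ℤ) : ℚ) ^ 2 * ((4 * c + 1 : ℤ) : ℚ) = ((trace α : ℤ) : ℚ) ^ 2 - 4 * (A : ℚ) ^ 3 := by
  have h1 := trace_sq_sub_four_mul_norm α
  rw [hα] at h1
  have : ((trace α ^ 2 - 4 * A ^ 3 : ℤ) : ℚ) = (((4 * c + 1) * α.im ^ 2 : ℤ) : ℚ) := by rw [h1]
  push_cast at this ⊢
  linarith

/-- The cube roots of $\alpha$ and $\bar\alpha$ are multiplied by $\xi/k$ and its conjugate. Their
product acquires $N(\xi)/k^2$, and the sum of their cubes becomes $\mathrm{Tr}(\alpha\xi^3)/k^3$. -/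
theorem twist_cube (hα : α.norm = A ^ 3) (hθ : ∀ r : ℚ, (r : K) ≠ θ)
    (h : θ ^ 3 = 3 * (A : K) * θ + ((trace α : ℤ) : K)) {k : ℤ} (hk : k ≠ 0) :
    twist α A θ ξ k ^ 3 = 3 * (((A * ξ.norm : ℤ) / k ^ 2 : ℚ) : K) * twist α A θ ξ k +
      (((trace (α * ξ ^ 3) : ℤ) / k ^ 3 : ℚ) : K) := by
  have him := im_ne_zero_of_root hα hθ h
  have hC : ((α.im : ℤ) : ℚ) ≠ 0 := by exact_mod_cast him
  have hk' : (k : ℚ) ≠ 0 := by exact_mod_cast hk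
  rw [twist, resolvent_cube (d := ((4 * c + 1 : ℤ) : ℚ)) hC (resolvent_hyp hα)
    (by push_cast; exact h)]
  congr 3
  · congr 1
    rw [norm_def]
    push_cast
    field_simp
    ring
  · simp only [pow_succ, pow_zero, one_mul, trace_def, re_mul, im_mul]
    push_cast
    field_simp
    ring

theorem twist_irrational (hneg : 4 * c + 1 < 0) (h3 : Module.finrank ℚ K = 3)
    (hα : α.norm = A ^ 3) (hθ : ∀ r : ℚ, (r : K) ≠ θ)
    (h : θ ^ 3 = 3 * (A : K) * θ + ((trace α : ℤ) : K)) (hξ : ξ ≠ 0) {k : ℤ} (hk : k ≠ 0)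
    (r : ℚ) : (r : K) ≠ twist α A θ ξ k := by
  have him := im_ne_zero_of_root hα hθ h
  have hC : ((α.im : ℤ) : ℚ) ≠ 0 := by exact_mod_cast him
  have hk' : (k : ℚ) ≠ 0 := by exact_mod_cast hk
  have hA : (A : ℚ) ≠ 0 := by
    intro h0
    have h0' : A = 0 := by exact_mod_cast h0
    subst h0'
    have := norm_eq_zero_of_neg hneg (hα.trans (by norm_num))
    exact him (by rw [this]; rfl)
  apply resolvent_irrational h3 hθ hA hC
  by_contra hcon
  push Not at hcon
  obtain ⟨e1, e2⟩ := hcon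
  have e2' : ξ.im = 0 := by
    have : (ξ.im : ℚ) = 0 := by field_simp at e2; simpa using e2
    exact_mod_cast this
  have e1' : ξ.re = 0 := by
    rw [e2'] at e1
    field_simp at e1
    have : (ξ.re : ℚ) = 0 := by push_cast at e1; linarith
    exact_mod_cast this
  exact hξ (by ext <;> simp [e1', e2'])

end Twist

/-- Replacing $\beta$ by $\gamma^3\beta$ multiplies $\beta^2\bar\beta$ by $(\gamma^2\bar\gamma)^3$,
so twisting by $\gamma^2\bar\gamma$ produces the new root in the same field. -/
theorem HasCubicRoot.mul_cube (hneg : 4 * c + 1 < 0) (h3 : Module.finrank ℚ K = 3)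
    {β γ : QuadOrder c} (hγ : γ ≠ 0) (h : HasCubicRoot K β) : HasCubicRoot K (γ ^ 3 * β) := by
  obtain ⟨θ, hθ, h⟩ := h
  have hγn := norm_ne_zero hneg hγ
  have hξ : γ ^ 2 * Star.star γ ≠ 0 := by
    intro h0
    have := norm_sq_mul_star γ
    rw [h0, QuadraticAlgebra.norm_zero] at this
    exact hγn (pow_eq_zero_iff three_ne_zero |>.1 this.symm)
  have hα := norm_sq_mul_star β
  have h' : θ ^ 3 = 3 * ((β.norm : ℤ) : K) * θ + ((trace (β ^ 2 * Star.star β) : ℤ) : K) := by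
    rw [trace_sq_mul_star]; exact h
  refine ⟨twist (β ^ 2 * Star.star β) β.norm θ (γ ^ 2 * Star.star γ) 1,
    twist_irrational hneg h3 hα hθ h' hξ one_ne_zero, ?_⟩
  rw [twist_cube hα hθ h' one_ne_zero]
  have e1 : β.norm * (γ ^ 2 * Star.star γ).norm = (γ ^ 3 * β).norm := by
    rw [norm_sq_mul_star, map_mul, map_pow]; ring
  have e2 : trace (β ^ 2 * Star.star β * (γ ^ 2 * Star.star γ) ^ 3) =
      (γ ^ 3 * β).norm * trace (γ ^ 3 * β) := by
    rw [← trace_sq_mul_star]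
    congr 1
    rw [star_mul, star_pow]
    ring
  rw [e1, e2]
  push_cast
  simp

/-- Division by $y^3$ is multiplication by $\bar y^3$ followed by removal of the rational factor
$N(y)^3$. -/
theorem HasCubicRoot.of_cube_mul_eq (hneg : 4 * c + 1 < 0) (h3 : Module.finrank ℚ K = 3)
    {β β' x y : QuadOrder c} (hx : x ≠ 0) (hy : y ≠ 0) (hxy : x ^ 3 * β = y ^ 3 * β')
    (h : HasCubicRoot K β) : HasCubicRoot K β' := by
  have h1 := h.mul_cube hneg h3 hx
  rw [hxy] at h1
  have hsy : Star.star y ≠ 0 := by simpa using hy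
  have h2 := h1.mul_cube hneg h3 hsy
  have hn := norm_ne_zero hneg hy
  refine h2.scale (r := 1) (s := y.norm ^ 3) one_ne_zero (pow_ne_zero 3 hn) ?_
  push_cast
  rw [intCast_norm]
  ring

/-- Two resolvents with roots in the same cubic field agree up to cubes and conjugation. -/
theorem HasCubicRoot.exists_cube_mul_eq (hneg : 4 * c + 1 < 0) (h3 : Module.finrank ℚ K = 3)
    {β γ : QuadOrder c} (h : HasCubicRoot K β) (h' : HasCubicRoot K γ) :
    ∃ (ξ : QuadOrder c) (k : ℤ), ξ ≠ 0 ∧ k ≠ 0 ∧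
      (β ^ 2 * Star.star β * ξ ^ 3 = (k : QuadOrder c) ^ 3 * (γ ^ 2 * Star.star γ) ∨
        β ^ 2 * Star.star β * ξ ^ 3 = (k : QuadOrder c) ^ 3 * (Star.star γ ^ 2 * γ)) := by
  obtain ⟨θ, hθ, h⟩ := h
  obtain ⟨φ, hφ, h'⟩ := h'
  set α := β ^ 2 * Star.star β with hαdef
  set A := β.norm with hA
  have hα : α.norm = A ^ 3 := norm_sq_mul_star β
  rw [← trace_sq_mul_star, ← hαdef] at h
  have him := im_ne_zero_of_root hα hθ h
  have hC : ((α.im : ℤ) : ℚ) ≠ 0 := by exact_mod_cast him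
  have hA0 : A ≠ 0 := by
    intro h0
    rw [h0] at hα
    have := norm_eq_zero_of_neg hneg (hα.trans (by norm_num))
    exact him (by rw [this]; rfl)
  have hA0' : (A : ℚ) ≠ 0 := by exact_mod_cast hA0
  obtain ⟨x, y, hxy⟩ := exists_eq_resolvent h3 hθ hφ (A := A) (B := (trace α : ℤ))
    (A' := (γ.norm : ℤ)) (B' := (γ.norm * trace γ : ℤ)) (C := (α.im : ℤ)) hA0' hC
    (by push_cast; exact h) (by push_cast; push_cast at h'; exact h')
  -- clear denominators
  obtain ⟨k, hk, u, v, hu, hv⟩ : ∃ k : ℤ, k ≠ 0 ∧ ∃ u v : ℤ, (u : ℚ) = k * (x - y) ∧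
      (v : ℚ) = k * (2 * y) := by
    refine ⟨(x - y).den * (2 * y).den, ?_, (x - y).num * (2 * y).den, (2 * y).num * (x - y).den,
      ?_, ?_⟩
    · exact_mod_cast mul_ne_zero (x - y).den_nz (2 * y).den_nz
    · push_cast
      nth_rewrite 3 [← Rat.num_div_den (x - y)]
      have : ((x - y).den : ℚ) ≠ 0 := by exact_mod_cast (x - y).den_nz
      field_simp
    · push_cast
      nth_rewrite 3 [← Rat.num_div_den (2 * y)]
      have : ((2 * y).den : ℚ) ≠ 0 := by exact_mod_cast (2 * y).den_nz
      field_simp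
  have hk' : (k : ℚ) ≠ 0 := by exact_mod_cast hk
  set ξ : QuadOrder c := ⟨u, v⟩ with hξ
  have htw : φ = twist α A θ ξ k := by
    rw [hxy, twist]
    congr 1
    · rw [hξ]; push_cast; rw [hu, hv]; field_simp; ring
    · rw [hξ]; rw [hv]; field_simp
  have hξ0 : ξ ≠ 0 := by
    intro h0
    rw [htw, h0] at hφ
    apply hφ 0
    simp [twist, resolvent]
  have hcube := twist_cube (ξ := ξ) hα hθ h hk
  rw [← htw, h'] at hcube
  -- Two depressed cubics vanish at `φ`. Their difference is linear, so irrationality of `φ` makes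
  -- the coefficients agree, and they are the norm and trace data of the two elements.
  obtain ⟨e1, e2, -⟩ := coeffs_eq_zero h3 hφ
    (p := (γ.norm * trace γ : ℤ) - (trace (α * ξ ^ 3) : ℤ) / k ^ 3)
    (q := 3 * (γ.norm : ℤ) - 3 * ((A * ξ.norm : ℤ) / k ^ 2)) (r := 0) (by
      push_cast at hcube ⊢; linear_combination hcube)
  have f1 : trace (α * ξ ^ 3) = k ^ 3 * (γ.norm * trace γ) := by
    have : ((trace (α * ξ ^ 3) : ℤ) : ℚ) = ((k ^ 3 * (γ.norm * trace γ) : ℤ) : ℚ) := by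
      rw [sub_eq_zero, eq_div_iff (pow_ne_zero 3 hk')] at e1
      rw [← e1]; push_cast; ring
    exact_mod_cast this
  have f2 : A * ξ.norm = k ^ 2 * γ.norm := by
    have : ((A * ξ.norm : ℤ) : ℚ) = ((k ^ 2 * γ.norm : ℤ) : ℚ) := by
      have e3 : ((γ.norm : ℤ) : ℚ) = (A * ξ.norm : ℤ) / k ^ 2 := by linarith
      rw [eq_div_iff (pow_ne_zero 2 hk')] at e3
      rw [← e3]; push_cast; ring
    exact_mod_cast this
  have g1 : trace (α * ξ ^ 3) = trace (((k ^ 3 : ℤ) : QuadOrder c) * (γ ^ 2 * Star.star γ)) := by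
    rw [trace_intCast_mul, trace_sq_mul_star, f1]
  have g2 : (α * ξ ^ 3).norm = (((k ^ 3 : ℤ) : QuadOrder c) * (γ ^ 2 * Star.star γ)).norm := by
    rw [norm_intCast_mul, norm_sq_mul_star, map_mul, map_pow, hα]
    calc A ^ 3 * ξ.norm ^ 3 = (A * ξ.norm) ^ 3 := by ring
      _ = _ := by rw [f2]; ring
  refine ⟨ξ, k, hξ0, hk, ?_⟩
  rcases eq_or_eq_star hneg g1 g2 with g | g
  · left; rw [g]; push_cast; rfl
  · right; rw [g]; simp

end CubicField

/-! ### From elements to cubic fields and back. -/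

namespace CubicField

open QuadOrder Ideal

variable {c : ℤ}

theorem isIntegral_of_cube {K : Type*} [Field K] {φ : K} {M T : ℤ}
    (h : φ ^ 3 = 3 * (M : K) * φ + T) : IsIntegral ℤ φ := by
  refine ⟨X ^ 3 - C (3 * M) * X - C T, by monicity!, ?_⟩
  rw [eval₂_sub, eval₂_sub, eval₂_mul, eval₂_pow, eval₂_X, eval₂_C, eval₂_C, h]
  simp

/-- The lattice of resolvents shows that the discriminant of the cubic field attached to a
generator of `b * e ^ 3` divides `-27 d N(b) ^ 2` with square quotient. -/
theorem HasCubicRoot.exists_sq_mul_discr [IsDedekindDomain (QuadOrder c)]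
    (hd : Squarefree (4 * c + 1)) (hneg : 4 * c + 1 < 0) {K : Type*} [Field K] [NumberField K]
    (h3 : Module.finrank ℚ K = 3) {β : QuadOrder c} (hβ : β ≠ 0) {b e : Ideal (QuadOrder c)}
    (hspan : span {β} = b * e ^ 3) (h : HasCubicRoot K β) :
    ∃ k : ℤ, -27 * (4 * c + 1) * (absNorm b : ℤ) ^ 2 = k ^ 2 * NumberField.discr K := by
  obtain ⟨θ, hθ, h⟩ := h
  set α := β ^ 2 * Star.star β with hαdef
  set A := β.norm with hA
  have hα : α.norm = A ^ 3 := norm_sq_mul_star β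
  rw [← trace_sq_mul_star, ← hαdef] at h
  have him := im_ne_zero_of_root hα hθ h
  have hC : ((α.im : ℤ) : ℚ) ≠ 0 := by exact_mod_cast him
  have he : e ≠ ⊥ := by
    rintro rfl
    rw [← Ideal.zero_eq_bot, zero_pow three_ne_zero, mul_zero, Ideal.zero_eq_bot,
      Ideal.span_singleton_eq_bot] at hspan
    exact hβ hspan
  set n : ℤ := (absNorm e : ℤ) with hn
  have hn0 : n ≠ 0 := by rw [hn]; exact_mod_cast absNorm_ne_zero hd he
  have hn0' : (n : ℚ) ≠ 0 := by exact_mod_cast hn0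
  have hAn : A = absNorm b * n ^ 3 := norm_eq_of_span_eq hneg hspan
  obtain ⟨x, y, hx, hy, hxy⟩ := exists_pair_of_ideal (conj_ne_bot he)
  rw [absNorm_conj, ← hn] at hxy
  -- The denominator `n ^ 2` is the one allowed by `dvd_of_mem_conj`: the two coefficients of the
  -- cubic are divided by $n^4$ and $n^6$.
  have hint : ∀ z ∈ conj e, IsIntegral ℤ (twist α A θ z (n ^ 2)) := by
    intro z hz
    obtain ⟨⟨M, hM⟩, ⟨w, hw⟩⟩ := dvd_of_mem_conj hd hneg hspan hz
    rw [← hn, ← hA] at hM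
    rw [← hn] at hw
    apply isIntegral_of_cube (M := M) (T := trace w)
    rw [twist_cube hα hθ h (pow_ne_zero 2 hn0), hM, hαdef, hw, trace_intCast_mul]
    congr 2
    · rw [← Rat.cast_intCast]
      congr 1
      push_cast
      field_simp
    · rw [← Rat.cast_intCast]
      push_cast
      field_simp
  obtain ⟨k, hk⟩ := exists_discr_eq_sq_mul h3 (hint x hx) (hint y hy)
  refine ⟨k, ?_⟩
  rw [twist, twist, discr_resolvent h3 hθ hC (resolvent_hyp hα) (by push_cast; exact h)] at hk
  have hxy' : ((x.re : ℚ) * y.im - y.re * x.im) ^ 2 = n ^ 2 := by exact_mod_cast hxy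
  have : ((-27 * (4 * c + 1) * (absNorm b : ℤ) ^ 2 : ℤ) : ℚ) =
      ((k ^ 2 * NumberField.discr K : ℤ) : ℚ) := by
    rw [← hk, hAn]
    push_cast
    have e1 : (2 * ((absNorm b : ℚ) * (n : ℚ) ^ 3) *
        ((2 * (x.re : ℚ) + x.im) / (2 * (n : ℚ) ^ 2) * (y.im / (2 * (n : ℚ) ^ 2)) -
          (2 * (y.re : ℚ) + y.im) / (2 * (n : ℚ) ^ 2) * (x.im / (2 * (n : ℚ) ^ 2)))) ^ 2 =
        (absNorm b : ℚ) ^ 2 * (((x.re : ℚ) * y.im - y.re * x.im) ^ 2 / n ^ 2) := by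
      field_simp
      ring
    rw [e1, hxy', div_self (pow_ne_zero 2 hn0')]
    ring
  exact_mod_cast this

/-- Cubic fields containing a root of the same resolvent are isomorphic. -/
theorem HasCubicRoot.nonempty_ringEquiv {K L : Type*} [Field K] [CharZero K] [Field L] [CharZero L]
    (hK : Module.finrank ℚ K = 3) (hL : Module.finrank ℚ L = 3) {β : QuadOrder c}
    (h : HasCubicRoot K β) (h' : HasCubicRoot L β) : Nonempty (K ≃+* L) := by
  obtain ⟨θ, hθ, h⟩ := h
  obtain ⟨φ, hφ, h'⟩ := h'
  obtain ⟨b, hb⟩ := exists_basis hK hθ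
  obtain ⟨b', hb'⟩ := exists_basis hL hφ
  set f : K ≃ₗ[ℚ] L := b.equiv b' (Equiv.refl _) with hf
  have hfb : ∀ i, f (b i) = b' i := fun i => b.equiv_apply i b' (Equiv.refl _)
  have hf' : ∀ p q r : ℚ, f ((p : K) + q * θ + r * θ ^ 2) = (p : L) + q * φ + r * φ ^ 2 := by
    intro p q r
    have h0 : (p : K) + q * θ + r * θ ^ 2 = p • b 0 + q • b 1 + r • b 2 := by
      rw [hb]; simp [Algebra.smul_def]
    rw [h0, map_add, map_add, map_smul, map_smul, map_smul, hfb, hfb, hfb, hb']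
    simp [Algebra.smul_def]
  set N : ℚ := ((β.norm : ℤ) : ℚ) with hN
  set T : ℚ := ((β.norm * trace β : ℤ) : ℚ) with hT
  have h1 : θ ^ 3 = 3 * (N : K) * θ + (T : K) := by
    rw [h, hN, hT]; push_cast; ring
  have h1' : φ ^ 3 = 3 * (N : L) * φ + (T : L) := by
    rw [h', hN, hT]; push_cast; ring
  refine ⟨{ f with map_mul' := fun x y => ?_, map_add' := f.map_add }⟩
  show f (x * y) = f x * f y
  obtain ⟨p, q, r, rfl⟩ := exists_coords hK hθ x
  obtain ⟨s, t, u, rfl⟩ := exists_coords hK hθ y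
  have e1 : ((p : K) + q * θ + r * θ ^ 2) * (s + t * θ + u * θ ^ 2) =
      ((p * s + (q * u + r * t) * T : ℚ) : K) +
      ((p * t + q * s + (q * u + r * t) * (3 * N) + r * u * T : ℚ) : K) * θ +
      ((p * u + q * t + r * s + r * u * (3 * N) : ℚ) : K) * θ ^ 2 := by
    push_cast
    linear_combination ((q : K) * u + r * t + r * u * θ) * h1
  rw [e1, hf', hf', hf']
  push_cast
  linear_combination (-((q : L) * u + r * t + r * u * φ)) * h1'

theorem exists_numberField_root {P : ℚ[X]} (hP : Irreducible P) (hdeg : 1 < P.natDegree) :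
    ∃ (K : Type) (_ : Field K) (_ : NumberField K), Module.finrank ℚ K = P.natDegree ∧
      ∃ θ : K, (∀ r : ℚ, (r : K) ≠ θ) ∧ aeval θ P = 0 := by
  have : Fact (Irreducible P) := ⟨hP⟩
  let pb := AdjoinRoot.powerBasis hP.ne_zero
  have hfin : Module.finrank ℚ (AdjoinRoot P) = P.natDegree := by
    rw [pb.finrank, AdjoinRoot.powerBasis_dim]
  have hroot : aeval (AdjoinRoot.root P) P = 0 := AdjoinRoot.eval₂_root P
  refine ⟨AdjoinRoot P, inferInstance,
    { to_charZero := charZero_of_injective_algebraMap (algebraMap ℚ (AdjoinRoot P)).injective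
      to_finiteDimensional := pb.finite }, hfin, AdjoinRoot.root P, ?_, hroot⟩
  intro r hr
  rw [← hr, ← eq_ratCast (algebraMap ℚ (AdjoinRoot P)), aeval_algebraMap_apply,
    map_eq_zero_iff _ (algebraMap ℚ (AdjoinRoot P)).injective] at hroot
  have := degree_eq_one_of_irreducible_of_root hP (x := r) (by simpa using hroot)
  rw [degree_eq_natDegree hP.ne_zero] at this
  have h1 : P.natDegree = 1 := by exact_mod_cast this
  omega

/-- If the resolvent polynomial is Eisenstein at some prime, there is a cubic field containing
one of its roots. -/
theorem exists_cubicField {β : QuadOrder c} {q : ℕ} (hq : q.Prime)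
    (h1 : (q : ℤ) ∣ β.norm) (h2 : ¬ (q : ℤ) ^ 2 ∣ β.norm) (h3 : ¬ (q : ℤ) ∣ trace β) :
    ∃ (K : Type) (_ : Field K) (_ : NumberField K), Module.finrank ℚ K = 3 ∧ HasCubicRoot K β := by
  have hqp : Prime (q : ℤ) := Nat.prime_iff_prime_int.1 hq
  set P : ℤ[X] := X ^ 3 - C (3 * β.norm) * X - C (β.norm * trace β) with hP
  have hmon : P.Monic := by rw [hP]; monicity!
  have hdeg : P.natDegree = 3 := by rw [hP]; compute_degree!
  have c0 : P.coeff 0 = -(β.norm * trace β) := by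
    rw [hP, coeff_sub, coeff_sub, coeff_C_mul, coeff_C, coeff_X_pow, coeff_X]; simp
  have c1 : P.coeff 1 = -(3 * β.norm) := by
    rw [hP, coeff_sub, coeff_sub, coeff_C_mul, coeff_C, coeff_X_pow, coeff_X]; simp
  have c2 : P.coeff 2 = 0 := by
    rw [hP, coeff_sub, coeff_sub, coeff_C_mul, coeff_C, coeff_X_pow, coeff_X]; simp
  have heis : P.IsEisensteinAt (span {(q : ℤ)}) := by
    refine ⟨?_, ?_, ?_⟩
    · rw [hmon.leadingCoeff, Ideal.mem_span_singleton]
      exact fun h => hqp.not_isUnit (isUnit_of_dvd_one h)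
    · intro n hn
      rw [hdeg] at hn
      rw [Ideal.mem_span_singleton]
      interval_cases n
      · rw [c0, dvd_neg]; exact h1.mul_right _
      · rw [c1, dvd_neg]; exact h1.mul_left _
      · rw [c2]; exact dvd_zero _
    · rw [c0, Ideal.span_singleton_pow, Ideal.mem_span_singleton, dvd_neg]
      intro h
      obtain ⟨m, hm⟩ := h1
      rw [hm, sq, mul_assoc] at h
      have h4 := (mul_dvd_mul_iff_left hqp.ne_zero).1 h
      rcases hqp.dvd_or_dvd h4 with h5 | h5
      · exact h2 (by rw [hm, sq]; exact mul_dvd_mul_left _ h5)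
      · exact h3 h5
  have hirr : Irreducible P := heis.irreducible
    ((Ideal.span_singleton_prime hqp.ne_zero).2 hqp) hmon.isPrimitive (by omega)
  have hirrQ : Irreducible (P.map (Int.castRingHom ℚ)) :=
    (Polynomial.IsPrimitive.Int.irreducible_iff_irreducible_map_cast hmon.isPrimitive).1 hirr
  have hdegQ : (P.map (Int.castRingHom ℚ)).natDegree = 3 := by
    rw [hmon.natDegree_map, hdeg]
  obtain ⟨K, hK, hnf, hfin, θ, hθ, h5⟩ := exists_numberField_root hirrQ (by omega)
  refine ⟨K, hK, hnf, by rw [hfin, hdegQ], θ, hθ, ?_⟩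
  rw [← algebraMap_int_eq, aeval_map_algebraMap, hP] at h5
  simp only [map_sub, map_mul, map_pow, aeval_X, eq_intCast, map_intCast] at h5
  push_cast at h5 ⊢
  linear_combination h5

/-- Every cubic field whose discriminant is `-27 d` times a nonzero square contains a root of a
resolvent polynomial. -/
theorem exists_hasCubicRoot {K : Type*} [Field K] [NumberField K]
    (hneg : 4 * c + 1 < 0) (h3 : Module.finrank ℚ K = 3) {n : ℤ}
    (hD : NumberField.discr K = -27 * (4 * c + 1) * n ^ 2) :
    ∃ β : QuadOrder c, β ≠ 0 ∧ HasCubicRoot K β := by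
  -- an irrational element
  obtain ⟨t, ht⟩ : ∃ t : K, ∀ r : ℚ, (r : K) ≠ t := by
    by_contra hcon
    push Not at hcon
    have : Module.finrank ℚ K ≤ 1 := finrank_le_one (1 : K) (fun w => by
      obtain ⟨r, hr⟩ := hcon w
      exact ⟨r, by rw [← hr, Algebra.smul_def]; simp⟩)
    omega
  obtain ⟨a0, a1, a2, ha⟩ := exists_coords h3 ht (t ^ 3)
  set θ : K := t - ((a2 / 3 : ℚ) : K) with hθdef
  have hθ : ∀ r : ℚ, (r : K) ≠ θ := by
    intro r hr
    apply ht (r + a2 / 3)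
    rw [hθdef] at hr
    push_cast at hr ⊢
    rw [hr]; ring
  obtain ⟨A, B, hAB⟩ : ∃ A B : ℚ, θ ^ 3 = 3 * A * θ + B := by
    -- Coefficients of the cubic after the shift by `a2 / 3` removes the quadratic term.
    refine ⟨(a1 + a2 ^ 2 / 3) / 3, a0 + a1 * a2 / 3 + 2 * a2 ^ 3 / 27, ?_⟩
    rw [hθdef]
    push_cast
    linear_combination ha
  -- its discriminant
  have hdisc := discr_powers h3 hθ hAB
  obtain ⟨b⟩ := exists_integral_basis h3
  obtain ⟨C, hC⟩ : ∃ C : ℚ, C ^ 2 * ((4 * c + 1 : ℤ) : ℚ) = B ^ 2 - 4 * A ^ 3 := by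
    obtain ⟨bθ, hbθ⟩ := exists_basis h3 hθ
    have hc := coe_discr_eq b
    rw [NumberField.discr_eq_discr K b, hD] at hc
    have hv : (fun i => (b i : K)) = Matrix.vecMul ![1, θ, θ ^ 2]
        ((bθ.toMatrix (fun i => (b i : K))).map (algebraMap ℚ K)) := by
      rw [← hbθ]; exact (Module.Basis.toMatrix_map_vecMul bθ _).symm
    rw [hv, Algebra.discr_of_matrix_vecMul, hdisc] at hc
    set r := (bθ.toMatrix (fun i => (b i : K))).det
    have hr : r ≠ 0 := by
      intro h0
      rw [h0] at hc
      have hz : NumberField.discr K = 0 := by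
        rw [hD]
        have : (((-27 * (4 * c + 1) * n ^ 2 : ℤ)) : ℚ) = 0 := by rw [hc]; ring
        exact_mod_cast this
      exact NumberField.discr_ne_zero K hz
    -- The discriminant of an integral basis is that of $1, \theta, \theta^2$ times $r^2$.
    -- Comparison with $-27dn^2$ leaves $B^2 - 4A^3 = d\,(n/r)^2$.
    refine ⟨n / r, ?_⟩
    push_cast at hc ⊢
    field_simp
    linear_combination (-1 / 27 : ℚ) * hc
  -- clear denominators
  obtain ⟨k, hk, A', B', C', hA', hB', hC'⟩ : ∃ k : ℤ, k ≠ 0 ∧ ∃ A' B' C' : ℤ,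
      (A' : ℚ) = k * A ∧ (B' : ℚ) = k * B ∧ (C' : ℚ) = k * C := by
    have hA := (Rat.mul_den_eq_num A).symm
    have hB := (Rat.mul_den_eq_num B).symm
    have hC := (Rat.mul_den_eq_num C).symm
    refine ⟨A.den * B.den * C.den, ?_, A.num * B.den * C.den, B.num * A.den * C.den,
      C.num * A.den * B.den, ?_, ?_, ?_⟩
    · exact_mod_cast mul_ne_zero (mul_ne_zero A.den_nz B.den_nz) C.den_nz
    · push_cast; rw [hA]; ring
    · push_cast; rw [hB]; ring
    · push_cast; rw [hC]; ring
  have hk' : (k : ℚ) ≠ 0 := by exact_mod_cast hk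
  -- This is $4k^3(B + C\sqrt d)$, that is, $(2k)^3$ times Cardano's radicand $(B + C\sqrt d)/2$,
  -- written in the basis $1, (1+\sqrt d)/2$. The matching root is $2k\theta$.
  set α : QuadOrder c := ⟨4 * k ^ 2 * (B' - C'), 8 * k ^ 2 * C'⟩ with hα
  have htr : trace α = 8 * k ^ 2 * B' := by rw [hα, trace_def]; ring
  set M : ℤ := 4 * k * A' with hM
  have hnorm : α.norm = M ^ 3 := by
    have h4 := trace_sq_sub_four_mul_norm α
    have h5 : C' ^ 2 * (4 * c + 1) * k = B' ^ 2 * k - 4 * A' ^ 3 := by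
      have : ((C' ^ 2 * (4 * c + 1) * k : ℤ) : ℚ) = ((B' ^ 2 * k - 4 * A' ^ 3 : ℤ) : ℚ) := by
        push_cast at hC ⊢; rw [hA', hB', hC']; linear_combination (k : ℚ) ^ 3 * hC
      exact_mod_cast this
    rw [htr] at h4
    have h6 : α.im = 8 * k ^ 2 * C' := rfl
    rw [h6] at h4
    have h7 : 4 * α.norm = 4 * M ^ 3 := by
      rw [hM]; linear_combination -h4 - 64 * k ^ 3 * h5
    linarith
  set φ : K := ((2 * k : ℤ) : K) * θ with hφ
  have hkK : ((2 * k : ℤ) : K) ≠ 0 := by exact_mod_cast mul_ne_zero two_ne_zero hk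
  have hφirr : ∀ r : ℚ, (r : K) ≠ φ := by
    intro r hr
    apply hθ (r / (2 * k : ℤ))
    push_cast at hr hkK hφ ⊢
    rw [hr, hφ]; field_simp
  have hφ3 : φ ^ 3 = 3 * (M : K) * φ + ((trace α : ℤ) : K) := by
    have e1 : (M : K) = 4 * k ^ 2 * (A : K) := by
      have : (M : ℚ) = 4 * k ^ 2 * A := by rw [hM]; push_cast; rw [hA']; ring
      exact_mod_cast congrArg (Rat.cast : ℚ → K) this
    have e2 : ((trace α : ℤ) : K) = 8 * k ^ 3 * (B : K) := by
      have : ((trace α : ℤ) : ℚ) = 8 * k ^ 3 * B := by rw [htr]; push_cast; rw [hB']; ring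
      exact_mod_cast congrArg (Rat.cast : ℚ → K) this
    rw [e1, e2, hφ]; push_cast
    linear_combination (8 * (k : K) ^ 3) * hAB
  have him := im_ne_zero_of_root hnorm hφirr hφ3
  have hα0 : α ≠ 0 := fun h0 => him (by rw [h0]; rfl)
  have hM0 : M ≠ 0 := by
    intro h0
    rw [h0] at hnorm
    exact hα0 (norm_eq_zero_of_neg hneg (hnorm.trans (by norm_num)))
  have hMK : (M : K) ≠ 0 := by exact_mod_cast hM0
  -- As $N(\alpha) = M^3$, the element $\alpha^2\bar\alpha = M^3\alpha$ differs from $\alpha$ by a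
  -- cube, so $\alpha$ itself serves as $\beta$, with root $M\varphi$.
  refine ⟨α, hα0, (M : K) * φ, fun r hr => hφirr (r / M) ?_, ?_⟩
  · push_cast; rw [hr]; field_simp
  · rw [hnorm]; push_cast
    linear_combination ((M : K) ^ 3) * hφ3

end CubicField

/-! ### Choices of one prime above each split rational prime. -/

namespace QuadOrder

open Ideal UniqueFactorizationMonoid

variable {c : ℤ}

section SignedProduct

variable {ι : Type*}

/-- A prime ideal or its conjugate, according to a sign. -/
def signed (P : Ideal (QuadOrder c)) (s : Bool) : Ideal (QuadOrder c) :=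
  if s then P else conj P

theorem conj_signed (P : Ideal (QuadOrder c)) (s : Bool) : conj (signed P s) = signed P (!s) := by
  cases s <;> simp [signed, conj_conj]

/-- The product of the ideals `P i` or their conjugates, according to signs. -/
def signedProd [Fintype ι] (P : ι → Ideal (QuadOrder c)) (ε : ι → Bool) : Ideal (QuadOrder c) :=
  ∏ i, signed (P i) (ε i)

theorem conj_signedProd [Fintype ι] (P : ι → Ideal (QuadOrder c)) (ε : ι → Bool) :
    conj (signedProd P ε) = signedProd P (fun i => !ε i) := by
  have h : conj (signedProd P ε) = ∏ i, conj (signed (P i) (ε i)) :=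
    map_prod (Ideal.mapHom ((starRingAut : QuadOrder c ≃+* QuadOrder c) :
      QuadOrder c →+* QuadOrder c)) _ _
  rw [h]
  exact Finset.prod_congr rfl fun i _ => conj_signed _ _

theorem signed_dvd_signedProd [Fintype ι] (P : ι → Ideal (QuadOrder c)) (ε : ι → Bool) (i : ι) :
    signed (P i) (ε i) ∣ signedProd P ε :=
  Finset.dvd_prod_of_mem _ (Finset.mem_univ i)

/-- A family of prime ideals lying over distinct split rational primes. -/
structure IsSplitFamily [IsDedekindDomain (QuadOrder c)] (P : ι → Ideal (QuadOrder c))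
    (q : ι → ℕ) : Prop where
  prime : ∀ i, (q i).Prime
  injective : Function.Injective q
  isPrime : ∀ i, (P i).IsPrime
  ne_bot : ∀ i, P i ≠ ⊥
  ne_conj : ∀ i, P i ≠ conj (P i)
  absNorm_eq : ∀ i, absNorm (P i) = q i

namespace IsSplitFamily

variable [IsDedekindDomain (QuadOrder c)] {P : ι → Ideal (QuadOrder c)} {q : ι → ℕ}

theorem signed_isPrime (h : IsSplitFamily P q) (i : ι) (s : Bool) : (signed (P i) s).IsPrime := by
  cases s
  · exact conj_isPrime (h.isPrime i)
  · exact h.isPrime i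

theorem signed_ne_bot (h : IsSplitFamily P q) (i : ι) (s : Bool) : signed (P i) s ≠ ⊥ := by
  cases s
  · exact conj_ne_bot (h.ne_bot i)
  · exact h.ne_bot i

theorem signed_prime (h : IsSplitFamily P q) (i : ι) (s : Bool) : Prime (signed (P i) s) :=
  Ideal.prime_of_isPrime (h.signed_ne_bot i s) (h.signed_isPrime i s)

theorem absNorm_signed (h : IsSplitFamily P q) (i : ι) (s : Bool) :
    absNorm (signed (P i) s) = q i := by
  cases s
  · exact (absNorm_conj _).trans (h.absNorm_eq i)
  · exact h.absNorm_eq i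

theorem signed_ne_not (h : IsSplitFamily P q) (i : ι) (s : Bool) :
    signed (P i) s ≠ signed (P i) (!s) := by
  cases s
  · exact (h.ne_conj i).symm
  · exact h.ne_conj i

theorem eq_of_signed_eq (h : IsSplitFamily P q) {i j : ι} {s s' : Bool}
    (he : signed (P i) s = signed (P j) s') : i = j := by
  apply h.injective
  rw [← h.absNorm_signed i s, he, h.absNorm_signed]

theorem absNorm_signedProd [Fintype ι] (h : IsSplitFamily P q) (ε : ι → Bool) :
    absNorm (signedProd P ε) = ∏ i, q i := by
  rw [signedProd, map_prod]
  exact Finset.prod_congr rfl fun i _ => h.absNorm_signed i _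

theorem exists_eq_signed [Fintype ι] (h : IsSplitFamily P q) {ε : ι → Bool} {S : Finset ι}
    {Q : Ideal (QuadOrder c)} (hQ : Q.IsPrime) (hQ0 : Q ≠ ⊥)
    (hdvd : Q ∣ ∏ i ∈ S, signed (P i) (ε i)) : ∃ i ∈ S, Q = signed (P i) (ε i) := by
  obtain ⟨i, hi, hd⟩ := (Ideal.prime_of_isPrime hQ0 hQ).exists_mem_finset_dvd hdvd
  refine ⟨i, hi, ?_⟩
  have hm := (h.signed_isPrime i (ε i)).isMaximal (h.signed_ne_bot i (ε i))
  exact (hm.eq_of_le hQ.ne_top (Ideal.dvd_iff_le.1 hd)).symm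

theorem isConjReduced [Fintype ι] [DecidableEq ι] (h : IsSplitFamily P q) (ε : ι → Bool) :
    IsConjReduced (signedProd P ε) := by
  intro Q hQ hQ0 hQd
  obtain ⟨i, -, rfl⟩ := h.exists_eq_signed hQ hQ0 hQd
  constructor
  · intro h2
    have h3 : signedProd P ε = signed (P i) (ε i) *
        ∏ j ∈ Finset.univ.erase i, signed (P j) (ε j) :=
      (Finset.mul_prod_erase _ _ (Finset.mem_univ i)).symm
    rw [h3, sq] at h2
    have h4 := (mul_dvd_mul_iff_left (h.signed_prime i (ε i)).ne_zero).1 h2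
    obtain ⟨j, hj, he⟩ := h.exists_eq_signed hQ hQ0 h4
    exact (Finset.ne_of_mem_erase hj) (h.eq_of_signed_eq he).symm
  · intro h2
    obtain ⟨j, -, he⟩ := h.exists_eq_signed (conj_isPrime hQ) (conj_ne_bot hQ0) h2
    rw [conj_signed] at he
    have := h.eq_of_signed_eq he
    subst this
    exact h.signed_ne_not i (ε i) he.symm

/-- For each $q_i$ some prime above it divides $b$. These primes are pairwise coprime, so their
product divides $b$, and equality follows by comparing norms. -/
theorem exists_eq_signedProd [Fintype ι] (hd : Squarefree (4 * c + 1)) (h : IsSplitFamily P q)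
    {b : Ideal (QuadOrder c)} (hb : IsConjReduced b) (hn : absNorm b = ∏ i, q i) :
    ∃ ε : ι → Bool, b = signedProd P ε := by
  have key : ∀ i, ∃ s : Bool, signed (P i) s ∣ b := by
    intro i
    obtain ⟨Q, J, hQ, hQ0, hQQ, hQJ, -, -⟩ := hb.exists_prime_factor hd (h.prime i)
      (hn ▸ Finset.dvd_prod_of_mem q (Finset.mem_univ i))
    have hdv : Q ∣ P i * conj (P i) := by
      rw [mul_conj hd, h.absNorm_eq i, ← hQQ]
      exact dvd_mul_right _ _
    have hQb : Q ∣ b := ⟨J, hQJ⟩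
    rcases (Ideal.prime_of_isPrime hQ0 hQ).dvd_or_dvd hdv with h1 | h1
    · have hm := (h.signed_isPrime i true).isMaximal (h.signed_ne_bot i true)
      have := hm.eq_of_le hQ.ne_top (Ideal.dvd_iff_le.1 h1)
      exact ⟨true, this ▸ hQb⟩
    · have hm := (h.signed_isPrime i false).isMaximal (h.signed_ne_bot i false)
      have := hm.eq_of_le hQ.ne_top (Ideal.dvd_iff_le.1 h1)
      exact ⟨false, this ▸ hQb⟩
  choose ε hε using key
  refine ⟨ε, ?_⟩
  have hdvd : signedProd P ε ∣ b := by
    refine Finset.prod_dvd_of_coprime ?_ fun i _ => hε i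
    intro i _ j _ hij
    have hm := (h.signed_isPrime i (ε i)).isMaximal (h.signed_ne_bot i (ε i))
    have hm' := (h.signed_isPrime j (ε j)).isMaximal (h.signed_ne_bot j (ε j))
    exact Ideal.isCoprime_iff_sup_eq.2
      (hm.coprime_of_ne hm' fun he => hij (h.eq_of_signed_eq he))
  obtain ⟨J, hJ⟩ := hdvd
  have h1 : absNorm b = absNorm b * absNorm J := by
    nth_rewrite 1 [hJ]
    rw [map_mul, h.absNorm_signedProd, hn]
  have h2 : absNorm b ≠ 0 := by
    rw [hn]; exact Finset.prod_ne_zero_iff.2 fun i _ => (h.prime i).ne_zero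
  have h3 : absNorm J = 1 := by
    apply Nat.eq_of_mul_eq_mul_left (Nat.pos_of_ne_zero h2); rw [← h1, mul_one]
  rw [Ideal.absNorm_eq_one_iff] at h3
  rw [hJ, h3, Ideal.mul_top]

end IsSplitFamily

end SignedProduct

variable [IsDedekindDomain (QuadOrder c)]

open Classical in
/-- The exponent of a prime ideal in a resolvent element, modulo cubes, distinguishes the prime
from its conjugate. -/
theorem not_conj_dvd_of_cube_mul_eq {β γ ξ κ : QuadOrder c} (hβ : β ≠ 0) (hγ : γ ≠ 0) (hξ : ξ ≠ 0)
    (hκ : κ ≠ 0) (heq : β ^ 2 * star β * ξ ^ 3 = κ ^ 3 * (γ ^ 2 * star γ))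
    {b b' e e' P : Ideal (QuadOrder c)} (hb : IsConjReduced b) (hb' : IsConjReduced b')
    (hbe : span {β} = b * e ^ 3) (hbe' : span {γ} = b' * e' ^ 3) (hP : P.IsPrime) (hP0 : P ≠ ⊥)
    (h1 : P ∣ b) : ¬ conj P ∣ b' := by
  intro h2
  have hPp : Prime P := Ideal.prime_of_isPrime hP0 hP
  set v : Ideal (QuadOrder c) → ℕ := fun I => (normalizedFactors I).count P with hv
  have vmul : ∀ I J : Ideal (QuadOrder c), I ≠ 0 → J ≠ 0 → v (I * J) = v I + v J := by
    intro I J hI hJ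
    simp only [hv]
    rw [normalizedFactors_mul hI hJ, Multiset.count_add]
  have vpow : ∀ (I : Ideal (QuadOrder c)) (k : ℕ), v (I ^ k) = k * v I := by
    intro I k
    simp only [hv]
    rw [normalizedFactors_pow, Multiset.count_nsmul]
  have v1 : ∀ I : Ideal (QuadOrder c), P ∣ I → ¬ P ^ 2 ∣ I → v I = 1 := by
    intro I hI hI2
    exact count_normalizedFactors_eq hPp.irreducible (normalize_eq P) (by rwa [pow_one]) hI2
  have v0 : ∀ I : Ideal (QuadOrder c), ¬ P ∣ I → v I = 0 := by
    intro I hI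
    exact count_normalizedFactors_eq hPp.irreducible (normalize_eq P) (by simp) (by simpa using hI)
  have nz : ∀ {z : QuadOrder c} {f g : Ideal (QuadOrder c)}, z ≠ 0 → span {z} = f * g ^ 3 →
      f ≠ 0 ∧ g ≠ 0 := by
    intro z f g hz hfg
    have h0 : f * g ^ 3 ≠ 0 := by rw [← hfg]; simpa using hz
    exact ⟨left_ne_zero_of_mul h0, fun hg => h0 (by simp [hg])⟩
  obtain ⟨hb0, he0⟩ := nz hβ hbe
  obtain ⟨hb0', he0'⟩ := nz hγ hbe'
  have hcbe : span {star β} = conj b * conj e ^ 3 := by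
    rw [← conj_span_singleton, hbe, conj_mul, conj_pow]
  have hcbe' : span {star γ} = conj b' * conj e' ^ 3 := by
    rw [← conj_span_singleton, hbe', conj_mul, conj_pow]
  have hsβ : star β ≠ 0 := by simpa using hβ
  have hsγ : star γ ≠ 0 := by simpa using hγ
  obtain ⟨hcb0, hce0⟩ := nz hsβ hcbe
  obtain ⟨hcb0', hce0'⟩ := nz hsγ hcbe'
  have hvb : v b = 1 := v1 b h1 (hb P hP hP0 h1).1
  have hvcb : v (conj b) = 0 := v0 _ fun h3 => by
    rw [← conj_dvd_conj, conj_conj] at h3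
    exact (hb P hP hP0 h1).2 h3
  have h2' : P ∣ conj b' := by rwa [← conj_dvd_conj, conj_conj]
  have hvcb' : v (conj b') = 1 := v1 _ h2' (hb'.conj P hP hP0 h2').1
  have hvb' : v b' = 0 := v0 _ fun h3 => (hb' P hP hP0 h3).2 h2
  -- Comparison of valuations at `P`: modulo $3$ the left side is $2\cdot 1 + 0$ and the right side
  -- is $2\cdot 0 + 1$.
  have hspan := congrArg (fun z => v (span {z})) heq
  simp only [← Ideal.span_singleton_mul_span_singleton, ← Ideal.span_singleton_pow] at hspan
  have s1 : span {β} ≠ (0 : Ideal (QuadOrder c)) := by simpa using hβ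
  have s2 : span {star β} ≠ (0 : Ideal (QuadOrder c)) := by simpa using hβ
  have s3 : span {γ} ≠ (0 : Ideal (QuadOrder c)) := by simpa using hγ
  have s4 : span {star γ} ≠ (0 : Ideal (QuadOrder c)) := by simpa using hγ
  have s5 : span {ξ} ≠ (0 : Ideal (QuadOrder c)) := by simpa using hξ
  have s6 : span {κ} ≠ (0 : Ideal (QuadOrder c)) := by simpa using hκ
  rw [vmul _ _ (mul_ne_zero (pow_ne_zero 2 s1) s2) (pow_ne_zero 3 s5),
    vmul _ _ (pow_ne_zero 2 s1) s2, vmul _ _ (pow_ne_zero 3 s6) (mul_ne_zero (pow_ne_zero 2 s3) s4),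
    vmul _ _ (pow_ne_zero 2 s3) s4, vpow, vpow, vpow, vpow, hbe, hcbe, hbe', hcbe',
    vmul _ _ hb0 (pow_ne_zero 3 he0), vmul _ _ hcb0 (pow_ne_zero 3 hce0),
    vmul _ _ hb0' (pow_ne_zero 3 he0'), vmul _ _ hcb0' (pow_ne_zero 3 hce0'), vpow, vpow, vpow,
    vpow, hvb, hvcb, hvb', hvcb'] at hspan
  omega

end QuadOrder

/-! ### The exact discriminant and the reduced ideal of a given field. -/

namespace CubicField

open QuadOrder Ideal

variable {c : ℤ} [IsDedekindDomain (QuadOrder c)] {K : Type*} [Field K] [NumberField K]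

/-- At a prime `q` dividing the norm of the reduced part, the index of `ℤ[θ]` is prime to `q`. -/
theorem HasCubicRoot.exists_index (hd : Squarefree (4 * c + 1)) (hneg : 4 * c + 1 < 0)
    (h3 : Module.finrank ℚ K = 3) {β : QuadOrder c} {b e : Ideal (QuadOrder c)}
    (hspan : span {β} = b * e ^ 3) (hb : IsConjReduced b)
    (hco : IsCoprime e (span {((absNorm b : ℤ) : QuadOrder c)})) (h : HasCubicRoot K β) {q : ℕ}
    (hq : q.Prime) (hqb : q ∣ absNorm b) :
    ∃ j : ℤ, -27 * (4 * c + 1) * (β.norm * β.im) ^ 2 = j ^ 2 * NumberField.discr K ∧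
      ¬ (q : ℤ) ∣ j := by
  obtain ⟨h1, h2, h4, -⟩ := hb.norm_trace hd hneg hspan hco hq hqb
  obtain ⟨θ, hθ, h⟩ := h
  have hqp : Prime (q : ℤ) := Nat.prime_iff_prime_int.1 hq
  obtain ⟨j, hj, hqj⟩ := not_dvd_index h3 hθ h hq h1 (h1.mul_right _) (by
    intro h5
    obtain ⟨m, hm⟩ := h1
    rw [hm, sq, mul_assoc] at h5
    rcases hqp.dvd_or_dvd ((mul_dvd_mul_iff_left hqp.ne_zero).1 h5) with h6 | h6
    · exact h2 (by rw [hm, sq]; exact mul_dvd_mul_left _ h6)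
    · exact h4 h6)
  refine ⟨j, ?_, hqj⟩
  rw [← hj]
  linear_combination (27 * β.norm ^ 2) * trace_sq_sub_four_mul_norm β

/-- The discriminant of the cubic field attached to a generator of `b * e ^ 3`. -/
theorem HasCubicRoot.discr_eq (hd : Squarefree (4 * c + 1)) (hneg : 4 * c + 1 < 0)
    (h3 : Module.finrank ℚ K = 3) {β : QuadOrder c} (hβ : β ≠ 0) {b e : Ideal (QuadOrder c)}
    (hspan : span {β} = b * e ^ 3) (hb : IsConjReduced b)
    (hco : IsCoprime e (span {((absNorm b : ℤ) : QuadOrder c)})) (h : HasCubicRoot K β)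
    (h3b : 3 ∣ absNorm b) :
    NumberField.discr K = -27 * (4 * c + 1) * (absNorm b : ℤ) ^ 2 := by
  obtain ⟨k, hk⟩ := h.exists_sq_mul_discr hd hneg h3 hβ hspan
  set m : ℤ := (absNorm b : ℤ) with hm
  set d : ℤ := 4 * c + 1 with hddef
  have hβn : β.norm = m * (absNorm e : ℤ) ^ 3 := norm_eq_of_span_eq hneg hspan
  have hm0 : m ≠ 0 := fun h0 => norm_ne_zero hneg hβ (by rw [hβn, h0, zero_mul])
  have hk1 : IsUnit k := by
    by_contra hku
    obtain ⟨q, hq, hqk⟩ := Int.exists_prime_and_dvd (n := k)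
      (fun h0 => hku (Int.isUnit_iff_natAbs_eq.2 h0))
    have hqn : q.natAbs.Prime := Int.prime_iff_natAbs_prime.1 hq
    have hqk' : ((q.natAbs : ℕ) : ℤ) ∣ k := by rwa [Int.natAbs_dvd]
    have hqp : Prime ((q.natAbs : ℕ) : ℤ) := Nat.prime_iff_prime_int.1 hqn
    by_cases hqm : q.natAbs ∣ absNorm b
    · obtain ⟨j, hj, hqj⟩ := h.exists_index hd hneg h3 hspan hb hco hqn hqm
      apply hqj
      have e1 : k ^ 2 * (β.norm * β.im) ^ 2 = j ^ 2 * m ^ 2 := by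
        have hne : (-27 * d : ℤ) ≠ 0 := mul_ne_zero (by norm_num) hneg.ne
        apply mul_left_cancel₀ hne
        linear_combination k ^ 2 * hj - j ^ 2 * hk
      rw [hβn] at e1
      have e2 : k ^ 2 * ((absNorm e : ℤ) ^ 3 * β.im) ^ 2 = j ^ 2 := by
        apply mul_left_cancel₀ (pow_ne_zero 2 hm0)
        linear_combination e1
      exact hqp.dvd_of_dvd_pow (n := 2) (e2 ▸ (Dvd.dvd.mul_right (dvd_pow hqk' two_ne_zero) _))
    -- As $3 \mid N(b)$, the prime differs from $3$. Its square therefore divides $d$, against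
    -- squarefreeness.
    · have hqm' : ¬ ((q.natAbs : ℕ) : ℤ) ∣ m := by rw [hm, Int.natCast_dvd_natCast]; exact hqm
      have hq3 : ¬ ((q.natAbs : ℕ) : ℤ) ∣ 3 := by
        intro h5
        have h6 : q.natAbs ∣ 3 := by exact_mod_cast h5
        exact hqm (h6.trans h3b)
      have h27 : IsCoprime (((q.natAbs : ℕ) : ℤ) ^ 2) (-27 * m ^ 2) := by
        have i1 : IsCoprime ((q.natAbs : ℕ) : ℤ) 3 := hqp.coprime_iff_not_dvd.2 hq3
        have i2 : IsCoprime ((q.natAbs : ℕ) : ℤ) m := hqp.coprime_iff_not_dvd.2 hqm'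
        have i3 : IsCoprime (((q.natAbs : ℕ) : ℤ) ^ 2) (3 ^ 3 * m ^ 2) :=
          (IsCoprime.mul_right i1.pow_right i2.pow_right).pow_left
        have i4 := i3.neg_right
        rwa [show -((3 : ℤ) ^ 3 * m ^ 2) = -27 * m ^ 2 by ring] at i4
      have h7 : ((q.natAbs : ℕ) : ℤ) ^ 2 ∣ d * (-27 * m ^ 2) := by
        rw [show d * (-27 * m ^ 2) = -27 * d * m ^ 2 by ring, hk]
        exact (pow_dvd_pow_of_dvd hqk' 2).mul_right _
      have h8 := h27.dvd_of_dvd_mul_right h7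
      exact hqp.not_isUnit (hd _ (by rwa [← sq]))
  have hk2 : k ^ 2 = 1 := by
    rcases Int.isUnit_iff.1 hk1 with h0 | h0 <;> rw [h0] <;> norm_num
  rw [hk2, one_mul] at hk
  exact hk.symm

/-- A cubic field of discriminant `-27 d n ^ 2` comes from a conjugation-reduced ideal of
norm `n`. -/
theorem exists_isConjReduced_of_discr (hd : Squarefree (4 * c + 1)) (hc : c ≤ -2)
    [Finite (ClassGroup (QuadOrder c))]
    (hCl : ∀ x : ClassGroup (QuadOrder c), x ^ 3 = 1 → x = 1)
    (h3 : Module.finrank ℚ K = 3) {n : ℕ}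
    (hD : NumberField.discr K = -27 * (4 * c + 1) * (n : ℤ) ^ 2) :
    ∃ (β : QuadOrder c) (b e : Ideal (QuadOrder c)), β ≠ 0 ∧ span {β} = b * e ^ 3 ∧
      IsConjReduced b ∧ absNorm b = n ∧ HasCubicRoot K β := by
  have hneg : 4 * c + 1 < 0 := by omega
  obtain ⟨β₀, hβ₀, hroot₀⟩ := exists_hasCubicRoot hneg h3 hD
  obtain ⟨r, s, β₁, b, e₁, hr, hs, hβ₁, hsr, hspan₁, hb⟩ := exists_isConjReduced hd _ β₀
    (span {β₀}) ⊤ hβ₀ (by rw [← Ideal.one_eq_top, one_pow, mul_one]) rfl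
  have hroot₁ := hroot₀.scale hr hs hsr
  have hb0 : b ≠ ⊥ := by
    rintro rfl
    rw [← Ideal.zero_eq_bot, zero_mul, Ideal.zero_eq_bot, Ideal.span_singleton_eq_bot] at hspan₁
    exact hβ₁ hspan₁
  have hN0 : absNorm b ≠ 0 := absNorm_ne_zero hd hb0
  obtain ⟨β, e, hβ, hspan, hco⟩ := exists_span_eq_mul_cube hCl hb0 (m := (absNorm b : ℤ))
    (by exact_mod_cast hN0)
  obtain ⟨x, y, hx, hy, hxy⟩ := QuadOrder.exists_cube_mul_eq hc hCl hβ₁ hβ hspan₁ hspan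
  have hroot := hroot₁.of_cube_mul_eq hneg h3 hx hy hxy
  refine ⟨β, b, e, hβ, hspan, hb, ?_, hroot⟩
  set m : ℕ := absNorm b with hm
  have hd0 : (-27 * (4 * c + 1) : ℤ) ≠ 0 := mul_ne_zero (by norm_num) hneg.ne
  obtain ⟨k, hk⟩ := hroot.exists_sq_mul_discr hd hneg h3 hβ hspan
  have hnm : n ∣ m := by
    rw [hD] at hk
    have e1 : (m : ℤ) ^ 2 = (k * n) ^ 2 := by
      apply mul_left_cancel₀ hd0
      linear_combination hk
    have e2 : (n : ℤ) ^ 2 ∣ (m : ℤ) ^ 2 := by rw [e1, mul_pow]; exact dvd_mul_left _ _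
    exact_mod_cast (Int.pow_dvd_pow_iff two_ne_zero).1 e2
  obtain ⟨u, hu⟩ := hnm
  by_cases hu1 : u = 1
  · rw [hu, hu1, mul_one]
  exfalso
  obtain ⟨q, hq, hqu⟩ := Nat.exists_prime_and_dvd hu1
  have hqm : q ∣ m := hu ▸ hqu.mul_left n
  have hqp : Prime (q : ℤ) := Nat.prime_iff_prime_int.1 hq
  obtain ⟨h1, h2, -, -⟩ := hb.norm_trace hd hneg hspan hco hq hqm
  -- The index at `q` is prime to `q`, so `q` already divides `n`. Together with `q ∣ u` this gives
  -- $q^2 \mid m$, although `q` divides the norm of `β` only once.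
  have hqn : q ∣ n := by
    obtain ⟨j, hj, hqj⟩ := hroot.exists_index hd hneg h3 hspan hb hco hq hqm
    rw [hD] at hj
    have e1 : (β.norm * β.im) ^ 2 = (j * n) ^ 2 := by
      apply mul_left_cancel₀ hd0
      linear_combination hj
    have e2 : (q : ℤ) ∣ (j * n) ^ 2 := by
      rw [← e1]; exact dvd_pow (h1.mul_right _) two_ne_zero
    rcases hqp.dvd_or_dvd (hqp.dvd_of_dvd_pow e2) with h5 | h5
    · exact absurd h5 hqj
    · exact_mod_cast h5
  apply h2
  have e3 : (q : ℤ) ^ 2 ∣ (m : ℤ) := by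
    rw [sq, hu]
    exact_mod_cast mul_dvd_mul hqn hqu
  rw [norm_eq_of_span_eq hneg hspan]
  exact e3.mul_right _

end CubicField

/-! ### Counting the fields by sign vectors. -/

open QuadOrder CubicField Ideal in
/-- The number of cubic fields of discriminant `-27 d n ^ 2`, where `n` is a product of distinct
primes that split in `ℚ(√d)`, one of them being `3`. -/
theorem card_cubicFieldClasses {c : ℤ} [IsDedekindDomain (QuadOrder c)]
    (hd : Squarefree (4 * c + 1)) (hc : c ≤ -2) [Finite (ClassGroup (QuadOrder c))]
    (hCl : ∀ x : ClassGroup (QuadOrder c), x ^ 3 = 1 → x = 1) {ι : Type*} [Fintype ι]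
    [DecidableEq ι] {P : Option ι → Ideal (QuadOrder c)} {q : Option ι → ℕ}
    (hS : IsSplitFamily P q) (hq3 : q none = 3) {n : ℕ}
    (hn : n = ∏ i, q i) {D : ℤ} (hD : D = -27 * (4 * c + 1) * (n : ℤ) ^ 2) :
    Finite (CubicFieldClasses D) ∧ Nat.card (CubicFieldClasses D) = 2 ^ Fintype.card ι := by
  have hneg : 4 * c + 1 < 0 := by omega
  have hn0 : n ≠ 0 := by
    rw [hn]; exact Finset.prod_ne_zero_iff.2 fun i _ => (hS.prime i).ne_zero
  -- Conjugation flips every sign and preserves the field. Fixing the sign at `none`, the prime $3$,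
  -- picks one vector from each pair.
  let ext : (ι → Bool) → Option ι → Bool := fun ε o => o.elim true ε
  have hNb : ∀ ε : ι → Bool, absNorm (signedProd P (ext ε)) = n := fun ε =>
    (hS.absNorm_signedProd _).trans hn.symm
  have hred : ∀ ε : ι → Bool, IsConjReduced (signedProd P (ext ε)) := fun ε => hS.isConjReduced _
  have hb0 : ∀ ε : ι → Bool, signedProd P (ext ε) ≠ ⊥ := by
    intro ε h0
    have := hNb ε
    rw [h0, Ideal.absNorm_bot] at this
    exact hn0 this.symm
  choose β e hβ hspan hco using fun ε : ι → Bool =>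
    exists_span_eq_mul_cube hCl (hb0 ε) (m := (n : ℤ)) (by exact_mod_cast hn0)
  have hco' : ∀ ε, IsCoprime (e ε) (span {((absNorm (signedProd P (ext ε)) : ℤ) : QuadOrder c)}) :=
    fun ε => by rw [hNb]; exact hco ε
  have h3n : 3 ∣ n := by
    rw [hn, ← hq3]; exact Finset.dvd_prod_of_mem q (Finset.mem_univ none)
  have hex : ∀ ε : ι → Bool, ∃ L : CubicFieldOfDiscr D, HasCubicRoot L.carrier (β ε) := by
    intro ε
    -- Irreducibility of the cubic comes from the Eisenstein criterion at $3$.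
    obtain ⟨h1, h2, h4, -⟩ := (hred ε).norm_trace hd hneg (hspan ε) (hco' ε) Nat.prime_three
      (by rw [hNb]; exact h3n)
    obtain ⟨K, hK, hnf, hfin, hroot⟩ := exists_cubicField Nat.prime_three h1 h2 h4
    have hdisc := hroot.discr_eq hd hneg hfin (hβ ε) (hspan ε) (hred ε) (hco' ε)
      (by rw [hNb]; exact h3n)
    exact ⟨⟨K, hfin, by rw [hdisc, hNb, hD]⟩, hroot⟩
  choose L hL using hex
  let f : (ι → Bool) → CubicFieldClasses D := fun ε => Quotient.mk _ (L ε)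
  have hinj : Function.Injective f := by
    intro ε δ hεδ
    obtain ⟨iso⟩ : Nonempty ((L ε).carrier ≃+* (L δ).carrier) := Quotient.exact hεδ
    have hroot : HasCubicRoot (L δ).carrier (β ε) := by
      obtain ⟨θ, hθ, h⟩ := hL ε
      refine ⟨iso θ, fun r hr => hθ r (iso.injective (by rw [← hr, map_ratCast])), ?_⟩
      rw [← map_pow, h]; simp only [map_add, map_mul, map_intCast, map_ofNat]
    obtain ⟨ξ, k, hξ, hk, hcase⟩ := hroot.exists_cube_mul_eq hneg (L δ).finrank_eq (hL δ)
    have hkR : (k : QuadOrder c) ≠ 0 := by exact_mod_cast hk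
    have key : ∀ o : Option ι, ∀ s : Bool, ext ε o = s → signed (P o) s ∣ signedProd P (ext ε) :=
      fun o s h => h ▸ signed_dvd_signedProd P (ext ε) o
    have key' : ∀ o : Option ι, ∀ s : Bool, ext δ o = s → signed (P o) s ∣ signedProd P (ext δ) :=
      fun o s h => h ▸ signed_dvd_signedProd P (ext δ) o
    rcases hcase with heq | heq
    · funext i
      by_contra hne
      refine not_conj_dvd_of_cube_mul_eq (hβ ε) (hβ δ) hξ hkR heq (hred ε) (hred δ) (hspan ε)
        (hspan δ) (hS.signed_isPrime (some i) (ε i)) (hS.signed_ne_bot (some i) (ε i))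
        (key (some i) (ε i) rfl) ?_
      rw [conj_signed]
      apply key' (some i)
      show δ i = !ε i
      revert hne; cases ε i <;> cases δ i <;> simp
    -- In the conjugate case the primes above $3$ would have to carry opposite signs, but both signs
    -- are `true`.
    · exfalso
      have hstar : span {star (β δ)} = conj (signedProd P (ext δ)) * conj (e δ) ^ 3 := by
        rw [← conj_span_singleton, hspan δ, QuadOrder.conj_mul, conj_pow]
      refine not_conj_dvd_of_cube_mul_eq (γ := star (β δ)) (hβ ε) (by simpa using hβ δ) hξ hkR
        (by rw [star_star]; exact heq) (hred ε) (hred δ).conj (hspan ε) hstar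
        (hS.signed_isPrime none true) (hS.signed_ne_bot none true) (key none true rfl) ?_
      rw [conj_dvd_conj]
      exact key' none true rfl
  have hsurj : Function.Surjective f := by
    intro C
    obtain ⟨M, rfl⟩ := Quotient.exists_rep C
    obtain ⟨γ, b, g, hγ, hγspan, hbred, hbn, hγroot⟩ := exists_isConjReduced_of_discr hd hc hCl
      M.finrank_eq (M.discr_eq.trans hD)
    obtain ⟨η, rfl⟩ := hS.exists_eq_signedProd hd hbred (hbn.trans hn)
    have finish : ∀ (γ : QuadOrder c) (g : Ideal (QuadOrder c)) (η : Option ι → Bool), γ ≠ 0 →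
        span {γ} = signedProd P η * g ^ 3 → HasCubicRoot M.carrier γ → η none = true →
        ∃ ε, f ε = Quotient.mk _ M := by
      intro γ g η hγ hγspan hγroot hη
      set ε : ι → Bool := fun i => η (some i) with hε
      have hext : ext ε = η := by
        funext o
        cases o with
        | none => exact hη.symm
        | some i => rfl
      refine ⟨ε, ?_⟩
      have hs := hspan ε
      rw [hext] at hs
      obtain ⟨x, y, hx, hy, hxy⟩ := QuadOrder.exists_cube_mul_eq hc hCl hγ (hβ ε) hγspan hs
      have hroot := hγroot.of_cube_mul_eq hneg M.finrank_eq hx hy hxy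
      exact Quotient.sound ((hL ε).nonempty_ringEquiv (L ε).finrank_eq M.finrank_eq hroot)
    by_cases hη : η none = true
    · exact finish γ g η hγ hγspan hγroot hη
    · refine finish (star γ) (conj g) (fun i => !η i) (by simpa using hγ) ?_ hγroot.star
        (by simpa using hη)
      rw [← conj_span_singleton, hγspan, QuadOrder.conj_mul, conj_pow, conj_signedProd]
  have hbij : Function.Bijective f := ⟨hinj, hsurj⟩
  refine ⟨Finite.of_surjective f hsurj, ?_⟩
  rw [← Nat.card_eq_of_bijective f hbij, Nat.card_fun, Nat.card_eq_fintype_card,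
    Nat.card_eq_fintype_card, Fintype.card_bool]

end

/-! ### From Kronecker symbols to split primes, and the theorem. -/

/-- A fundamental discriminant at which `2` splits is squarefree and congruent to `1` mod `8`. -/
theorem IsFundamentalDiscriminant.of_kronecker_two {d : ℤ} (hd : IsFundamentalDiscriminant d)
    (h2 : kroneckerAtPrime d 2 = 1) : Squarefree d ∧ d % 8 = 1 := by
  have h8 : d % 8 = 1 ∨ d % 8 = 7 := by
    rw [kroneckerAtPrime, if_pos rfl, ZMod.χ₈_int_eq_if_mod_eight] at h2
    split_ifs at h2 with h0 h1 <;> simp_all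
  rcases hd with ⟨h4, hsq⟩ | ⟨m, rfl, -, -⟩
  · exact ⟨hsq, by omega⟩
  · omega

/-- The minimal polynomial of `(1 + √d) / 2` has distinct roots modulo a split prime. -/
theorem exists_root_of_kronecker {c : ℤ} (h8 : (4 * c + 1) % 8 = 1) {p : ℕ} (hp : p.Prime)
    (hk : kroneckerAtPrime (4 * c + 1) p = 1) :
    ∃ r : ℤ, (p : ℤ) ∣ r ^ 2 - r - c ∧ ¬ (p : ℤ) ∣ 2 * r - 1 := by
  by_cases hp2 : p = 2
  · subst hp2
    -- $d \equiv 1 \pmod 8$ makes `c` even, so `0` is a root.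
    refine ⟨0, by push_cast; omega, by norm_num⟩
  · have : Fact p.Prime := ⟨hp⟩
    rw [kroneckerAtPrime, if_neg hp2, ← jacobiSym.legendreSym.to_jacobiSym] at hk
    have hd0 : ((4 * c + 1 : ℤ) : ZMod p) ≠ 0 := by
      intro h0
      rw [(legendreSym.eq_zero_iff p _).2 h0] at hk
      exact zero_ne_one hk
    have hpd : ¬ (p : ℤ) ∣ 4 * c + 1 := by
      rwa [← ZMod.intCast_zmod_eq_zero_iff_dvd]
    obtain ⟨x, hx⟩ := (legendreSym.eq_one_iff p hd0).1 hk
    obtain ⟨y, rfl⟩ := ZMod.intCast_surjective x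
    have hpy : (p : ℤ) ∣ y ^ 2 - (4 * c + 1) := by
      rw [← ZMod.intCast_zmod_eq_zero_iff_dvd]
      push_cast at hx ⊢
      rw [hx]; ring
    have hpodd : (p : ℤ) % 2 = 1 := by
      have := hp.eq_two_or_odd
      omega
    -- A square root `y` of $d$ modulo `p` gives the root $(1+y)/2$; for even `y` it is replaced by
    -- `y + p`.
    obtain ⟨r, hr⟩ : ∃ r : ℤ, (p : ℤ) ∣ (2 * r - 1) - y := by
      rcases Int.even_or_odd' y with ⟨k, hk | hk⟩
      · exact ⟨(y + p + 1) / 2, 1, by omega⟩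
      · exact ⟨k + 1, 0, by omega⟩
    have hpp : Prime (p : ℤ) := Nat.prime_iff_prime_int.1 hp
    have h1 : (p : ℤ) ∣ 4 * (r ^ 2 - r - c) := by
      have : 4 * (r ^ 2 - r - c) =
          ((2 * r - 1) - y) * ((2 * r - 1) + y) + (y ^ 2 - (4 * c + 1)) := by
        ring
      rw [this]
      exact dvd_add (hr.mul_right _) hpy
    refine ⟨r, ?_, ?_⟩
    · rcases hpp.dvd_or_dvd h1 with h | h
      · exfalso
        have h2 : (p : ℤ) ∣ 2 := hpp.dvd_of_dvd_pow (n := 2) (by norm_num; exact h)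
        have h3 : p ∣ 2 := by exact_mod_cast h2
        exact hp2 ((Nat.prime_dvd_prime_iff_eq hp Nat.prime_two).1 h3)
      · exact h
    · intro h2
      have h3 : (p : ℤ) ∣ y := by
        have := dvd_sub h2 hr
        simpa using this
      exact hpd (by
        have := dvd_sub (dvd_pow h3 two_ne_zero) hpy
        simpa using this)

theorem mainTheorem5 (t : ℕ) (ht : 0 < t) (p : Fin t → ℕ)
    (hp : ∀ i, (p i).Prime) (hp_inj : Function.Injective p)
    (hp_mod : ∀ i, p i % 3 = 2) (hp_first : p ⟨0, ht⟩ = 2)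
    (n : ℕ) (hn : n = 3 * ∏ i, p i)
    (D : ℤ) (hD : D ∈ sigmaPlus n)
    (F : Type*) [Field F] [CharZero F]
    (s : F) (hs : s ^ 2 = -3 * (D : F)) (hF : IntermediateField.adjoin ℚ {s} = ⊤)
    (hCl : ∀ c : ClassGroup (𝓞 F), c ^ 3 = 1 → c = 1) :
    Finite (CubicFieldClasses D) ∧ Nat.card (CubicFieldClasses D) = 2 ^ t := by
  obtain ⟨⟨d, hDd, hfund, -, hkron⟩, hDpos⟩ := hD
  set q : Option (Fin t) → ℕ := fun o => o.elim 3 p with hq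
  have hnq : n = ∏ i, q i := by rw [hn, Fintype.prod_option, hq]; rfl
  have hqprime : ∀ i, (q i).Prime := by
    rintro (_ | i)
    · exact Nat.prime_three
    · exact hp i
  have hqn : ∀ i, q i ∣ n := fun i => hnq ▸ Finset.dvd_prod_of_mem q (Finset.mem_univ i)
  have hqinj : Function.Injective q := by
    have h3 : ∀ i, p i ≠ 3 := fun i h => by have := hp_mod i; omega
    rintro (_ | i) (_ | j) h
    · rfl
    · exact absurd h.symm (h3 j)
    · exact absurd h (h3 i)
    · exact congrArg some (hp_inj h)
  obtain ⟨hsq, h8⟩ := hfund.of_kronecker_two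
    (hkron 2 Nat.prime_two (hp_first ▸ hqn (some ⟨0, ht⟩)))
  have hn0 : (n : ℤ) ≠ 0 := by
    rw [hnq]; exact_mod_cast Finset.prod_ne_zero_iff.2 fun i _ => (hqprime i).ne_zero
  have hdneg : d < 0 := by
    have h1 : 0 < (n : ℤ) ^ 2 := by positivity
    by_contra h0
    have : 0 ≤ d * (n : ℤ) ^ 2 := mul_nonneg (by omega) h1.le
    rw [hDd] at hDpos
    linarith
  obtain ⟨c, rfl⟩ : ∃ c, d = 4 * c + 1 := ⟨d / 4, by omega⟩
  have hc : c ≤ -2 := by omega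
  -- the field `F` is `ℚ(√d)`
  have hn0F : (n : F) ≠ 0 := by exact_mod_cast hn0
  -- $s^2 = -3D = 81\,d\,n^2$, so this is a square root of $d$.
  set δ : F := s / (9 * n) with hδdef
  have hsδ : s = ((9 * n : ℚ) : F) * δ := by rw [hδdef]; push_cast; field_simp
  have hδ : δ ^ 2 = ((4 * c + 1 : ℤ) : F) := by
    rw [hδdef, div_pow, hs, hDd]; push_cast; field_simp; ring
  have hFδ : IntermediateField.adjoin ℚ {δ} = ⊤ := by
    rw [eq_top_iff, ← hF, IntermediateField.adjoin_simple_le_iff, hsδ]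
    exact mul_mem (by
      rw [← eq_ratCast (algebraMap ℚ F)]
      exact IntermediateField.algebraMap_mem _ _)
      (IntermediateField.mem_adjoin_simple_self ℚ δ)
  have hnf : NumberField F := numberField_of_adjoin_sqrt hδ hFδ
  obtain ⟨φ⟩ := nonempty_ringEquiv_ringOfIntegers (c := c) rfl hsq hdneg hδ
    (exists_rat_coords_of_adjoin_eq_top hδ hFδ)
  have hded : IsDedekindDomain (QuadOrder c) :=
    { φ.toMulEquiv.isDomain (𝓞 F) with
      toIsNoetherian := isNoetherianRing_of_ringEquiv (𝓞 F) φ.symm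
      toDimensionLEOne := Ring.DimensionLEOne.of_ringEquiv φ
      toIsIntegralClosure := IsIntegrallyClosed.of_equiv φ.symm }
  let ψ : ClassGroup (QuadOrder c) ≃* ClassGroup (𝓞 F) := ClassGroup.mulEquiv φ
  have hfin : Finite (ClassGroup (QuadOrder c)) := Finite.of_equiv _ ψ.symm.toEquiv
  have hCl' : ∀ x : ClassGroup (QuadOrder c), x ^ 3 = 1 → x = 1 := fun x hx =>
    ψ.injective (by rw [map_one]; exact hCl _ (by rw [← map_pow, hx, map_one]))
  have hsplit : ∀ i, ∃ P : Ideal (QuadOrder c), P.IsPrime ∧ P ≠ ⊥ ∧ P ≠ QuadOrder.conj P ∧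
      P * QuadOrder.conj P = Ideal.span {((q i : ℤ) : QuadOrder c)} ∧ Ideal.absNorm P = q i := by
    intro i
    obtain ⟨r, hr, hr2⟩ := exists_root_of_kronecker h8 (hqprime i) (hkron _ (hqprime i) (hqn i))
    exact QuadOrder.exists_split_prime (hqprime i) hr hr2
  choose P hP hP0 hne _ hN using hsplit
  have := card_cubicFieldClasses hsq hc hCl' ⟨hqprime, hqinj, hP, hP0, hne, hN⟩ rfl
    hnq hDd
  rwa [Fintype.card_fin] at this
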